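/- Let $d\in\mathbb N$, $\gamma\in(0,1)$, $T>0$. Let $\mathscr F_d$ be the set of (non-planar) rooted forests with vertices decorated by $\{1,\dots,d\}$, with empty forest $\mathbf 1$, commutative forest product $\odot$ (disjoint union), number of vertices $|\zeta|$, and grafting $\lfloor\zeta\rfloor_i$ of a forest $\zeta$ onto a new root decorated by $i$. Let $H=\langle\mathscr F_d\rangle$ be the real vector space with basis $\mathscr F_d$, with the bilinear product $\odot$, the linear map $\varepsilon(\zeta)=\delta_{\mathbf 1,\zeta}$, and the Connes–Kreimer coproduct, i.e. the algebra homomorphism $\Delta_\star:H\to H\otimes H$ with $\Delta_\star\mathbf 1=\mathbf 1\otimes\mathbf 1$ and $\Delta_\star\lfloor\zeta\rfloor_i=\lfloor\zeta\rfloor_i\otimes\mathbf 1+(\mathrm{id}\otimes\lfloor\cdot\rfloor_i)\Delta_\star\zeta$. **Branched rough paths.** $\hat{\mathscr R}^\gamma([0,T],\mathbb R^d)$ is the set of maps $\hat X:[0,T]^2\to H^*$ into the algebraic dual such that for all $s,u,t\in[0,T]$ and all forests $\zeta,\zeta_1,\zeta_2$: 1. $\hat X_{st}(\mathbf 1)=1$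 and $\hat X_{st}(\zeta_1\odot\zeta_2)=\hat X_{st}(\zeta_1)\hat X_{st}(\zeta_2)$; 2. $\hat X_{tt}=\varepsilon$ and $\hat X_{st}(\zeta)=(\hat X_{su}\otimes\hat X_{ut})\Delta_\star\zeta$; 3. $\sup_{s\ne t}|\hat X_{st}(\zeta)|\,/\,|t-s|^{\gamma|\zeta|}<\infty$. **Models.** The Connes–Kreimer regularity structure has index set $\gamma\mathbb N_0$, model space $H=\bigoplus_{k}H_k$ (algebraic direct sum) with $H_k=\mathrm{span}\{\zeta:|\zeta|=k\}$ in homogeneity $k\gamma$, and structure group $G=\{(g\otimes\mathrm{id})\Delta_\star: g:H\to\mathbb R\text{ a unital algebra homomorphism}\}$. Let $\|\cdot\|$ be the Euclidean norm on $H$ for which $\mathscr F_d$ is orthonormal, and $\|x\|_m$ the norm of the component of $x$ in $H_m$. A model on $\mathbb R$ is a pair $(\Pi,\Gamma)$, where $\Pi_s:H\to\mathscr S'(\mathbb R)$ is linear for every $s\in\mathbb R$ and $\Gamma:\mathbb R^2\to G$, such that for all $s,u,t\in\mathbb R$ $$\Gamma_{ss}=\mathrm{id},\qquad \Gamma_{su}\Gamma_{ut}=\Gamma_{st},\qquad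 \Pi_s\Gamma_{st}=\Pi_t,$$ and such that for every compact $K\subset\mathbb R$ and $k\in\mathbb N_0$ there is a constant $C$ with $$\|\Gamma_{st}a\|_m\le C\|a\|\,|s-t|^{\gamma(k-m)},\qquad |(\Pi_s a)(\mathfrak S^\delta_s u)|\le C\|a\|\,\delta^{\gamma k}$$ for all $s,t\in K$, $a\in H_k$, integers $0\le m<k$, $\delta\in(0,1]$ and all smooth real $u$ with compact support in $(-1,1)$, $\|u\|_\infty\le1$ and $\|u'\|_\infty\le 1$; here $(\mathfrak S_s^\delta u)(y)=\delta^{-1}u(\delta^{-1}(y-s))$. Let $\mathscr M_1^{\mathrm f}([0,T])$ be the set of those models for which $\Pi_s\mathbf 1$ is the constant function $1$ for all $s\in\mathbb R$, and $\Gamma_{st}=\mathrm{id}$ whenever $s,t\in(-\infty,0]$ or $s,t\in[T,\infty)$. **Theorem.** There is a bijection $I:\hat{\mathscr R}^\gamma([0,T],\mathbb R^d)\to\mathscr M_1^{\mathrm f}([0,T])$ that maps each $\hat X$ to the unique $(\Pi,\Gamma)\in\mathscr M_1^{\mathrm f}([0,T])$ such that for all $s\in[0,T]$ and $x\in H$ the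 distribution $\Pi_s x$ is given by a continuous function on $\mathbb R$, and $$(\Pi_s x)(t)=\hat X_{st}(x),\qquad \Gamma_{st}x=(\hat X_{ts}\otimes\mathrm{id})\Delta_\star x\qquad\text{for all } s,t\in[0,T],\ x\in H.$$ -/

import Mathlib

open scoped TensorProduct SchwartzMap

noncomputable section

namespace ConnesKreimer

/-! ### Decorated rooted forests -/

/-- Planar rooted forests with vertices decorated by `I`.  The forest `cons i a r` consists of a
first tree, whose root has decoration `i` and whose root is joined to the trees of `a`, followed by
the trees of `r`. -/
inductive PlanarForest (I : Type) : Type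
  | empty : PlanarForest I
  | cons (root : I) (children rest : PlanarForest I) : PlanarForest I

namespace PlanarForest

variable {I : Type}

/-- Number of vertices. -/
def size : PlanarForest I → ℕ
  | empty => 0
  | cons _ a r => (a.size + 1) + r.size

/-- Juxtaposition of planar forests. -/
def append : PlanarForest I → PlanarForest I → PlanarForest I
  | empty, q => q
  | cons i a r, q => cons i a (append r q)

/-- Two planar forests are the same nonplanar forest if one is obtained from the other by permuting
trees, at every level. -/
inductive Reorder : PlanarForest I → PlanarForest I → Prop
  | refl (p : PlanarForest I) : Reorder p p
  | symm {p q : PlanarForest I} : Reorder p q → Reorder q p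
  | trans {p q r : PlanarForest I} : Reorder p q → Reorder q r → Reorder p r
  | cons (i : I) {a a' r r' : PlanarForest I} :
      Reorder a a' → Reorder r r' → Reorder (.cons i a r) (.cons i a' r')
  | swap (i j : I) (a b r : PlanarForest I) :
      Reorder (.cons i a (.cons j b r)) (.cons j b (.cons i a r))

/-- Planar forests up to reordering. -/
def setoid (I : Type) : Setoid (PlanarForest I) :=
  ⟨Reorder, Reorder.refl, Reorder.symm, Reorder.trans⟩

theorem Reorder.size_eq {p q : PlanarForest I} (h : Reorder p q) : p.size = q.size := by
  induction h with
  | refl p => rfl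
  | symm _ ih => exact ih.symm
  | trans _ _ ih₁ ih₂ => exact ih₁.trans ih₂
  | cons i _ _ ih₁ ih₂ => simp only [size, ih₁, ih₂]
  | swap i j a b r => simp only [size]; omega

theorem append_empty (p : PlanarForest I) : p.append .empty = p := by
  induction p with
  | empty => rfl
  | cons i a r _ ih => simp only [append, ih]

theorem append_assoc (p q r : PlanarForest I) :
    (p.append q).append r = p.append (q.append r) := by
  induction p with
  | empty => rfl
  | cons i a s _ ih => simp only [append, ih]

theorem Reorder.append_left {p p' : PlanarForest I} (h : Reorder p p') (q : PlanarForest I) :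
    Reorder (p.append q) (p'.append q) := by
  induction h with
  | refl p => exact .refl _
  | symm _ ih => exact ih.symm
  | trans _ _ ih₁ ih₂ => exact ih₁.trans ih₂
  | cons i h₁ _ _ ih₂ => exact .cons i h₁ ih₂
  | swap i j a b r => exact .swap i j a b _

theorem Reorder.append_right (p : PlanarForest I) {q q' : PlanarForest I} (h : Reorder q q') :
    Reorder (p.append q) (p.append q') := by
  induction p with
  | empty => exact h
  | cons i a r _ ih => exact .cons i (.refl a) ih

theorem reorder_append_cons (i : I) (a p q : PlanarForest I) :
    Reorder (.cons i a (p.append q)) (p.append (.cons i a q)) := by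
  induction p with
  | empty => exact .refl _
  | cons j b r _ ih => exact (Reorder.swap i j a b _).trans (.cons j (.refl b) ih)

theorem reorder_append_comm (p q : PlanarForest I) : Reorder (p.append q) (q.append p) := by
  induction p with
  | empty => rw [append_empty]; exact .refl _
  | cons i a r _ ih => exact (Reorder.cons i (.refl a) ih).trans (reorder_append_cons i a q r)

end PlanarForest

/-- The set of (nonplanar) rooted forests with vertices decorated by `I`. -/
def Forest (I : Type) : Type := Quotient (PlanarForest.setoid I)

namespace Forest

variable {I : Type}

/-- The forests form a commutative monoid under the forest product `⊙` (disjoint union), the unit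
being the empty forest. -/
instance : CommMonoid (Forest I) where
  mul := Quotient.map₂ PlanarForest.append fun _ p' hp q _ hq =>
    (PlanarForest.Reorder.append_left hp q).trans (PlanarForest.Reorder.append_right p' hq)
  one := Quotient.mk (PlanarForest.setoid I) .empty
  mul_assoc := by
    rintro ⟨p⟩ ⟨q⟩ ⟨r⟩
    exact congrArg (Quotient.mk (PlanarForest.setoid I)) (PlanarForest.append_assoc p q r)
  one_mul := by
    rintro ⟨p⟩
    rfl
  mul_one := by
    rintro ⟨p⟩
    exact congrArg (Quotient.mk (PlanarForest.setoid I)) (PlanarForest.append_empty p)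
  mul_comm := by
    rintro ⟨p⟩ ⟨q⟩
    exact Quotient.sound (s := PlanarForest.setoid I) (PlanarForest.reorder_append_comm p q)

/-- `⌊ζ⌋ᵢ`: the tree obtained by joining the trees of `ζ` to a new root with decoration `i`. -/
def graft (i : I) : Forest I → Forest I :=
  Quotient.map (fun p => .cons i p .empty) fun _ _ h => .cons i h (.refl _)

/-- `|ζ|`: the number of vertices of `ζ`. -/
def size : Forest I → ℕ :=
  Quotient.lift PlanarForest.size fun _ _ h => PlanarForest.Reorder.size_eq h

end Forest

/-! ### The Connes–Kreimer Hopf algebra -/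

/-- The real vector space `⟨𝓕_d⟩` with basis the forests decorated by `{1, …, d}`, with the
commutative algebra structure given by the bilinear extension of the forest product. -/
abbrev ForestSpace (d : ℕ) : Type := MonoidAlgebra ℝ (Forest (Fin d))

variable {d : ℕ}

/-- The basis vector of the forest space belonging to a forest. -/
abbrev basisForest (ζ : Forest (Fin d)) : ForestSpace d := MonoidAlgebra.single ζ 1

/-- The linear extension of `⌊·⌋ᵢ`. -/
def graftLin (i : Fin d) : ForestSpace d →ₗ[ℝ] ForestSpace d :=
  MonoidAlgebra.mapDomainLinearMap ℝ ℝ (Forest.graft i)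

/-- The recursion of the coproduct `Δ_⋆`, on planar representatives. -/
def coproductPlanar : PlanarForest (Fin d) → ForestSpace d ⊗[ℝ] ForestSpace d
  | .empty => 1
  | .cons i a r =>
      (basisForest (Forest.graft i (Quotient.mk (PlanarForest.setoid _) a)) ⊗ₜ[ℝ] 1
        + LinearMap.lTensor (ForestSpace d) (graftLin i) (coproductPlanar a))
      * coproductPlanar r

theorem coproductPlanar_reorder {p q : PlanarForest (Fin d)} (h : PlanarForest.Reorder p q) :
    coproductPlanar p = coproductPlanar q := by
  induction h with
  | refl p => rfl
  | symm _ ih => exact ih.symm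
  | trans _ _ ih₁ ih₂ => exact ih₁.trans ih₂
  | @cons i a a' r r' h₁ _ ih₁ ih₂ =>
    have ha : Quotient.mk (PlanarForest.setoid (Fin d)) a = Quotient.mk _ a' := Quotient.sound h₁
    simp only [coproductPlanar, ih₁, ih₂, ha]
  | swap i j a b r =>
    simp only [coproductPlanar]
    exact mul_left_comm _ _ _

theorem coproductPlanar_append (p q : PlanarForest (Fin d)) :
    coproductPlanar (p.append q) = coproductPlanar p * coproductPlanar q := by
  induction p with
  | empty => exact (one_mul _).symm
  | cons i a r _ ih => simp only [PlanarForest.append, coproductPlanar, ih, mul_assoc]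

/-- The Connes–Kreimer coproduct `Δ_⋆` on `⟨𝓕_d⟩`, as an algebra homomorphism. -/
def coproduct : ForestSpace d →ₐ[ℝ] ForestSpace d ⊗[ℝ] ForestSpace d :=
  MonoidAlgebra.lift ℝ _ (Forest (Fin d))
    { toFun := Quotient.lift coproductPlanar fun _ _ h => coproductPlanar_reorder h
      map_one' := rfl
      map_mul' := by
        rintro ⟨p⟩ ⟨q⟩
        exact coproductPlanar_append p q }

/-- Together with `map_one` and `map_mul`, this is the recursion that defines `Δ_⋆`:
`Δ_⋆ ⌊ζ⌋ᵢ = ⌊ζ⌋ᵢ ⊗ 1 + (id ⊗ ⌊·⌋ᵢ) Δ_⋆ ζ`. -/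
theorem coproduct_graft (i : Fin d) (ζ : Forest (Fin d)) :
    coproduct (basisForest (Forest.graft i ζ)) =
      basisForest (Forest.graft i ζ) ⊗ₜ[ℝ] 1
        + LinearMap.lTensor (ForestSpace d) (graftLin i) (coproduct (basisForest ζ)) := by
  obtain ⟨p⟩ := ζ
  have h (q : PlanarForest (Fin d)) :
      coproduct (basisForest (Quotient.mk (PlanarForest.setoid _) q)) = coproductPlanar q :=
    (MonoidAlgebra.lift_single _ _ _).trans (one_smul _ _)
  exact (h _).trans <| by
    rw [coproductPlanar, coproductPlanar, mul_one, ← h p]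
    rfl

/-- The counit `ε`, `ε(ζ) = δ_{1,ζ}`. -/
def counit : ForestSpace d →ₗ[ℝ] ℝ :=
  (Finsupp.lapply 1) ∘ₗ (MonoidAlgebra.coeffLinearEquiv ℝ).toLinearMap

/-- `(g ⊗ id) Δ_⋆` for a linear functional `g` on the forest space. -/
def leftAction (g : Module.Dual ℝ (ForestSpace d)) : ForestSpace d →ₗ[ℝ] ForestSpace d :=
  (TensorProduct.lid ℝ (ForestSpace d)).toLinearMap ∘ₗ
    LinearMap.rTensor (ForestSpace d) g ∘ₗ coproduct.toLinearMap

/-- The convolution `(g ⊗ h) Δ_⋆` of two linear functionals. -/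
def convolution (g h : Module.Dual ℝ (ForestSpace d)) : Module.Dual ℝ (ForestSpace d) :=
  (TensorProduct.lid ℝ ℝ).toLinearMap ∘ₗ TensorProduct.map g h ∘ₗ coproduct.toLinearMap

/-! ### Branched rough paths -/

/-- `X : [0,T]² → ⟨𝓕_d⟩*` is a `γ`-Hölder branched rough path. -/
structure IsBranchedRoughPath (γ T : ℝ)
    (X : Set.Icc (0 : ℝ) T → Set.Icc (0 : ℝ) T → Module.Dual ℝ (ForestSpace d)) : Prop where
  map_one : ∀ s t, X s t 1 = 1
  map_mul : ∀ s t, ∀ ζ₁ ζ₂ : Forest (Fin d),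
    X s t (basisForest ζ₁ * basisForest ζ₂) = X s t (basisForest ζ₁) * X s t (basisForest ζ₂)
  diag : ∀ t, X t t = counit
  chen : ∀ s u t, ∀ ζ : Forest (Fin d),
    X s t (basisForest ζ) = convolution (X s u) (X u t) (basisForest ζ)
  holder : ∀ ζ : Forest (Fin d), ∃ C : ℝ, ∀ s t, s ≠ t →
    |X s t (basisForest ζ)| / |(t : ℝ) - (s : ℝ)| ^ (γ * (ζ.size : ℝ)) ≤ C

/-- The set of `d`-dimensional `γ`-Hölder branched rough paths on `[0,T]`. -/
def branchedRoughPaths (d : ℕ) (γ T : ℝ) :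
    Set (Set.Icc (0 : ℝ) T → Set.Icc (0 : ℝ) T → Module.Dual ℝ (ForestSpace d)) :=
  {X | IsBranchedRoughPath γ T X}

/-! ### The regularity structure

Index set `A = γ ℕ₀` (levels are indexed below by `k : ℕ` instead of `kγ`), model space
`T = ⟨𝓕_d⟩ = ⨁ₖ T_{kγ}`, and structure group the operators `(g ⊗ id) Δ_⋆`, `g` a character. -/

/-- The homogeneous component `T_{kγ}` of the model space: the span of the forests with `k`
vertices. It is finite-dimensional. -/
def level (d k : ℕ) : Submodule ℝ (ForestSpace d) :=
  Submodule.span ℝ (basisForest '' {ζ : Forest (Fin d) | ζ.size = k})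

/-- The norm `‖x‖ = √⟨x, x⟩` for the inner product in which the forests are orthonormal. -/
def forestNorm (x : ForestSpace d) : ℝ := √(x.coeff.sum fun _ c => c ^ 2)

/-- The canonical projection of the model space onto its `k`-th homogeneous component. -/
def levelProj (k : ℕ) (x : ForestSpace d) : ForestSpace d :=
  MonoidAlgebra.ofCoeff (x.coeff.filter fun ζ => ζ.size = k)

/-- The seminorm `‖x‖_{kγ}`, the norm of the `k`-th homogeneous component. -/
def levelNorm (k : ℕ) (x : ForestSpace d) : ℝ := forestNorm (levelProj k x)

/-- The structure group: the operators `(g ⊗ id) Δ_⋆` with `g` a character of the forest algebra,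
i.e. a unital algebra homomorphism to `ℝ`. -/
def structureGroup (d : ℕ) : Set (ForestSpace d →ₗ[ℝ] ForestSpace d) :=
  {Φ | ∃ g : ForestSpace d →ₐ[ℝ] ℝ, Φ = leftAction g.toLinearMap}

/-! ### Models on the real line -/

/-- `Γ : ℝ × ℝ → G`, with `G` the structure group, satisfies the algebraic and analytic conditions
required of the second component of a model. -/
structure IsBimap (γ : ℝ) (Γ : ℝ → ℝ → ForestSpace d →ₗ[ℝ] ForestSpace d) : Prop where
  mem : ∀ s t, Γ s t ∈ structureGroup d
  diag : ∀ s, Γ s s = LinearMap.id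
  comp : ∀ s u t, Γ s u ∘ₗ Γ u t = Γ s t
  bound : ∀ K : Set ℝ, IsCompact K → ∀ k : ℕ, ∃ C : ℝ,
    ∀ s ∈ K, ∀ t ∈ K, ∀ a ∈ level d k, ∀ m : ℕ, m < k →
      levelNorm m (Γ s t a) ≤ C * forestNorm a * |s - t| ^ (γ * (k : ℝ) - γ * (m : ℝ))

/-- Real tempered distributions on `ℝ`. -/
abbrev Tempered : Type := 𝓢(ℝ, ℝ) →L[ℝ] ℝ

/-- The recentred and rescaled function `y ↦ δ⁻¹ u (δ⁻¹ (y - s))`, for `δ ≠ 0`. -/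
def rescale (s δ : ℝ) (hδ : δ ≠ 0) (u : 𝓢(ℝ, ℝ)) : 𝓢(ℝ, ℝ) :=
  δ⁻¹ • SchwartzMap.compSubConstCLM ℝ s (SchwartzMap.compCLMOfContinuousLinearEquiv ℝ
    (ContinuousLinearEquiv.unitsEquivAut ℝ (Units.mk0 δ⁻¹ (inv_ne_zero hδ))) u)

theorem rescale_apply (s δ : ℝ) (hδ : δ ≠ 0) (u : 𝓢(ℝ, ℝ)) (y : ℝ) :
    rescale s δ hδ u y = δ⁻¹ * u (δ⁻¹ * (y - s)) := by
  simp [rescale, mul_comm]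

/-- The test functions: smooth `u` with compact support in the open ball `B(0,1)` and
`‖u‖_{C^1} ≤ 1`. (The order `1` is the smallest integer `r > |min A| = 0`.) -/
def testFunctions : Set 𝓢(ℝ, ℝ) :=
  {u | tsupport u ⊆ Metric.ball 0 1 ∧ ∀ y, |u y| ≤ 1 ∧ |deriv u y| ≤ 1}

/-- `(Π, Γ)` is a model on `ℝ` for the Connes–Kreimer regularity structure. -/
structure IsModel (γ : ℝ) (P : ℝ → ForestSpace d →ₗ[ℝ] Tempered)
    (Γ : ℝ → ℝ → ForestSpace d →ₗ[ℝ] ForestSpace d) : Prop where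
  bimap : IsBimap γ Γ
  comp : ∀ s t, P s ∘ₗ Γ s t = P t
  bound : ∀ K : Set ℝ, IsCompact K → ∀ k : ℕ, ∃ C : ℝ,
    ∀ s ∈ K, ∀ δ : ℝ, ∀ hδ : 0 < δ, δ ≤ 1 → ∀ a ∈ level d k, ∀ u ∈ testFunctions,
      |P s a (rescale s δ hδ.ne' u)| ≤ C * forestNorm a * δ ^ (γ * (k : ℝ))

/-- The tempered distribution `ξ` is (given by integration against) the continuous function `f`. -/
def IsContinuousFunction (ξ : Tempered) (f : ℝ → ℝ) : Prop :=
  Continuous f ∧ ∀ u : 𝓢(ℝ, ℝ),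
    MeasureTheory.Integrable (fun t => f t * u t) ∧ ξ u = ∫ t, f t * u t

/-- The models `(Π, Γ)` on `ℝ` such that `Π_s 1` is the constant function one for every `s` and such
that `Γ_{st} = id` for `s, t ∈ (-∞, 0]` and for `s, t ∈ [T, ∞)`. -/
def normalizedModels (d : ℕ) (γ T : ℝ) :
    Set ((ℝ → ForestSpace d →ₗ[ℝ] Tempered) ×
      (ℝ → ℝ → ForestSpace d →ₗ[ℝ] ForestSpace d)) :=
  {M | IsModel γ M.1 M.2 ∧
    (∀ s, IsContinuousFunction (M.1 s 1) fun _ => 1) ∧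
    (∀ s t, s ≤ 0 → t ≤ 0 → M.2 s t = LinearMap.id) ∧
    (∀ s t, T ≤ s → T ≤ t → M.2 s t = LinearMap.id)}

/-- The relation between `X` and `(Π, Γ)`: for `s, t ∈ [0,T]` and `x` in the forest space, `Π_s x` is
a continuous function with `(Π_s x)(t) = X_{st}(x)`, and `Γ_{st} x = (X_{ts} ⊗ id) Δ_⋆ x`. -/
def Corresponds {T : ℝ}
    (X : Set.Icc (0 : ℝ) T → Set.Icc (0 : ℝ) T → Module.Dual ℝ (ForestSpace d))
    (M : (ℝ → ForestSpace d →ₗ[ℝ] Tempered) ×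
      (ℝ → ℝ → ForestSpace d →ₗ[ℝ] ForestSpace d)) : Prop :=
  (∀ (s : Set.Icc (0 : ℝ) T) (x : ForestSpace d), ∃ f : ℝ → ℝ,
    IsContinuousFunction (M.1 s x) f ∧ ∀ t : Set.Icc (0 : ℝ) T, f t = X s t x) ∧
  (∀ (s t : Set.Icc (0 : ℝ) T) (x : ForestSpace d), M.2 s t x = leftAction (X t s) x)

end ConnesKreimer

end

open ConnesKreimer

/-!
A branched rough path on `[0, T]`, extended by constants to `ℝ`, and the family `ε ∘ Γ_{ts}` of a
model are both locally Hölder families `Y_{st}` of characters with `Y_{su} ⋆ Y_{ut} = Y_{st}`. Since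
`(g ⊗ id) Δ_⋆` determines `g` through the counit, such a family is the same thing as the second
component of a model, and for a normalized model that component is determined by its restriction to
`[0, T]²`. The functions `t ↦ Y_{st}(x)` are continuous and bounded when `Y` comes from `[0, T]`,
hence are tempered distributions, and they form the first component of a model with
`Γ_{st} = (Y_{ts} ⊗ id) Δ_⋆`.

What remains is that `Γ` and `Π 1 = 1` determine `Π`. If `Π` and `Π'` are two candidates, then
`Π_s ζ - Π'_s ζ` vanishes for `ζ = 1` and is of order `δ^γ` at scale `δ` around `s` otherwise;
re-expanding `Π_t` around `s` by means of `Γ_{st}` shows that the distribution `Π_t ζ - Π'_t ζ` is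
of order `δ^γ` at scale `δ` around every point, locally uniformly, and only the zero distribution
has a positive order at all points.
-/

noncomputable section

namespace ConnesKreimer

open Asymptotics Filter MeasureTheory Set Topology

variable {d : ℕ}

/-! ### Forests and the Connes–Kreimer bialgebra -/

namespace Forest

variable {I : Type}

theorem induction {motive : Forest I → Prop} (one : motive 1)
    (graft_mul : ∀ i a r, motive a → motive r → motive (graft i a * r)) (ζ : Forest I) :
    motive ζ := by
  obtain ⟨p⟩ := ζ
  induction p with
  | empty => exact one
  | cons i a r iha ihr => exact graft_mul i _ _ iha ihr

@[simp] theorem size_one : (1 : Forest I).size = 0 := rfl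

@[simp] theorem size_graft (i : I) (a : Forest I) : (graft i a).size = a.size + 1 := by
  obtain ⟨p⟩ := a
  rfl

theorem size_graft_mul (i : I) (a r : Forest I) :
    (graft i a * r).size = a.size + 1 + r.size := by
  obtain ⟨p⟩ := a
  obtain ⟨q⟩ := r
  rfl

@[simp] theorem size_mul (a b : Forest I) : (a * b).size = a.size + b.size := by
  induction a using induction with
  | one => simp
  | graft_mul i a r _ ih => rw [mul_assoc, size_graft_mul, size_graft_mul, ih]; omega

theorem size_eq_zero {a : Forest I} : a.size = 0 ↔ a = 1 := by
  refine ⟨fun h => ?_, fun h => h ▸ rfl⟩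
  induction a using induction with
  | one => rfl
  | graft_mul i a r _ _ => rw [size_graft_mul] at h; omega

theorem graft_ne_one (i : I) (a : Forest I) : graft i a ≠ 1 := by
  rw [Ne, ← size_eq_zero, size_graft]
  omega

theorem mul_eq_one_iff {a b : Forest I} : a * b = 1 ↔ a = 1 ∧ b = 1 := by
  simp only [← size_eq_zero, size_mul, Nat.add_eq_zero_iff]

theorem finite_setOf_size_le [Finite I] (n : ℕ) : {a : Forest I | a.size ≤ n}.Finite := by
  induction n with
  | zero =>
    exact (Set.finite_singleton 1).subset fun a ha => size_eq_zero.1 (Nat.le_zero.1 ha)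
  | succ n ih =>
    have hgraft := (Set.finite_univ (α := I)).prod (ih.prod ih)
    refine ((hgraft.image fun p => graft p.1 p.2.1 * p.2.2).union
      (Set.finite_singleton 1)).subset fun a ha => ?_
    induction a using induction with
    | one => exact Or.inr rfl
    | graft_mul i a r _ _ =>
      have hsize : a.size + 1 + r.size ≤ n + 1 := size_graft_mul i a r ▸ ha
      have ha' : a.size ≤ n := by omega
      have hr' : r.size ≤ n := by omega
      exact Or.inl ⟨(i, a, r), ⟨Set.mem_univ _, ha', hr'⟩, rfl⟩

theorem finite_setOf_size_eq [Finite I] (n : ℕ) : {a : Forest I | a.size = n}.Finite :=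
  (finite_setOf_size_le n).subset fun _ h => le_of_eq h

end Forest

theorem basisForest_one : basisForest (1 : Forest (Fin d)) = 1 := rfl

theorem basisForest_mul (a b : Forest (Fin d)) :
    basisForest (a * b) = basisForest a * basisForest b := by
  simp only [basisForest, MonoidAlgebra.single_mul_single, mul_one]

theorem linearMap_ext {V : Type*} [AddCommMonoid V] [Module ℝ V] {f g : ForestSpace d →ₗ[ℝ] V}
    (h : ∀ ζ, f (basisForest ζ) = g (basisForest ζ)) : f = g := by
  refine LinearMap.ext fun x => ?_
  induction x using MonoidAlgebra.induction_linear with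
  | zero => rw [map_zero, map_zero]
  | add x y hx hy => rw [map_add, map_add, hx, hy]
  | single ζ c =>
    have hsmul : (MonoidAlgebra.single ζ c : ForestSpace d) = c • basisForest ζ := by simp
    rw [hsmul, map_smul, map_smul, h]

theorem graftLin_basisForest (i : Fin d) (ζ : Forest (Fin d)) :
    graftLin i (basisForest ζ) = basisForest (Forest.graft i ζ) := by
  simp [graftLin, basisForest]

theorem algHom_ext_graft {A : Type*} [Semiring A] [Algebra ℝ A] {f g : ForestSpace d →ₐ[ℝ] A}
    (h : ∀ i ζ, f (basisForest ζ) = g (basisForest ζ) →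
      f (basisForest (Forest.graft i ζ)) = g (basisForest (Forest.graft i ζ))) : f = g := by
  refine AlgHom.toLinearMap_injective (linearMap_ext fun ζ => ?_)
  simp only [AlgHom.toLinearMap_apply]
  induction ζ using Forest.induction with
  | one => rw [basisForest_one, map_one, map_one]
  | graft_mul i a r iha ihr => rw [basisForest_mul, map_mul, map_mul, h i a iha, ihr]

theorem counit_apply (x : ForestSpace d) : counit x = x.coeff 1 := rfl

theorem counit_basisForest_of_ne_one {ζ : Forest (Fin d)} (h : ζ ≠ 1) :
    counit (basisForest ζ) = 0 := by
  rw [counit_apply, MonoidAlgebra.coeff_single, Finsupp.single_eq_of_ne' h]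

@[simp] theorem counit_one : counit (1 : ForestSpace d) = 1 := by
  rw [counit_apply, ← basisForest_one, MonoidAlgebra.coeff_single, Finsupp.single_eq_same]

theorem counit_comp_graftLin (i : Fin d) : counit ∘ₗ graftLin i = 0 :=
  linearMap_ext fun ζ => by
    rw [LinearMap.comp_apply, graftLin_basisForest,
      counit_basisForest_of_ne_one (Forest.graft_ne_one i ζ), LinearMap.zero_apply]

theorem counit_basisForest_mul (a b : Forest (Fin d)) :
    counit (basisForest (a * b)) = counit (basisForest a) * counit (basisForest b) := by
  by_cases ha : a = 1
  · rw [ha, one_mul, basisForest_one, counit_one, one_mul]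
  · rw [counit_basisForest_of_ne_one ha, zero_mul,
      counit_basisForest_of_ne_one fun h => ha (Forest.mul_eq_one_iff.1 h).1]

/-- The counit `ε` as an algebra homomorphism. -/
def counitHom : ForestSpace d →ₐ[ℝ] ℝ :=
  MonoidAlgebra.lift ℝ ℝ (Forest (Fin d))
    { toFun := fun ζ => counit (basisForest ζ)
      map_one' := counit_one
      map_mul' := counit_basisForest_mul }

theorem counitHom_toLinearMap : (counitHom (d := d)).toLinearMap = counit :=
  linearMap_ext fun _ => (MonoidAlgebra.lift_single _ _ _).trans (one_smul _ _)

theorem rTensor_counit_coproduct (x : ForestSpace d) :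
    counit.rTensor (ForestSpace d) (coproduct x) = 1 ⊗ₜ[ℝ] x := by
  have h : (Algebra.TensorProduct.map counitHom (AlgHom.id ℝ (ForestSpace d))).comp coproduct =
      Algebra.TensorProduct.includeRight := algHom_ext_graft fun i ζ ih => by
    change counitHom.toLinearMap.rTensor _ (coproduct _) = 1 ⊗ₜ[ℝ] _ at ih ⊢
    rw [counitHom_toLinearMap] at ih ⊢
    rw [coproduct_graft, map_add, LinearMap.rTensor_tmul,
      counit_basisForest_of_ne_one (Forest.graft_ne_one i ζ), TensorProduct.zero_tmul, zero_add,
      ← LinearMap.comp_apply, LinearMap.rTensor_comp_lTensor, ← LinearMap.lTensor_comp_rTensor,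
      LinearMap.comp_apply, ih, LinearMap.lTensor_tmul, graftLin_basisForest]
  rw [← counitHom_toLinearMap]
  exact AlgHom.congr_fun h x

theorem lTensor_counit_coproduct (x : ForestSpace d) :
    counit.lTensor (ForestSpace d) (coproduct x) = x ⊗ₜ[ℝ] 1 := by
  have h : (Algebra.TensorProduct.map (AlgHom.id ℝ (ForestSpace d)) counitHom).comp coproduct =
      Algebra.TensorProduct.includeLeft := algHom_ext_graft fun i ζ _ => by
    change counitHom.toLinearMap.lTensor _ (coproduct _) = _ ⊗ₜ[ℝ] 1
    rw [counitHom_toLinearMap, coproduct_graft, map_add,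
      ← LinearMap.comp_apply (LinearMap.lTensor _ _), ← LinearMap.lTensor_comp,
      counit_comp_graftLin, LinearMap.lTensor_zero, LinearMap.zero_apply, add_zero,
      LinearMap.lTensor_tmul, counit_one]
  rw [← counitHom_toLinearMap]
  exact AlgHom.congr_fun h x

theorem coproduct_comp_graftLin (i : Fin d) :
    coproduct.toLinearMap ∘ₗ graftLin i =
      (TensorProduct.mk ℝ (ForestSpace d) (ForestSpace d)).flip 1 ∘ₗ graftLin i +
        (graftLin i).lTensor (ForestSpace d) ∘ₗ coproduct.toLinearMap :=
  linearMap_ext fun ζ => by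
    simp only [LinearMap.comp_apply, LinearMap.add_apply, graftLin_basisForest,
      AlgHom.toLinearMap_apply, coproduct_graft, LinearMap.flip_apply, TensorProduct.mk_apply]

theorem assoc_lTensor_tmul {R M N N' P : Type*} [CommSemiring R] [AddCommMonoid M]
    [AddCommMonoid N] [AddCommMonoid N'] [AddCommMonoid P] [Module R M] [Module R N] [Module R N']
    [Module R P] (f : N →ₗ[R] N') (c : P) (z : M ⊗[R] N) :
    TensorProduct.assoc R M N' P (f.lTensor M z ⊗ₜ[R] c) =
      LinearMap.lTensor M ((TensorProduct.mk R N' P).flip c ∘ₗ f) z := by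
  induction z with
  | zero => simp only [map_zero, TensorProduct.zero_tmul]
  | add x y hx hy => simp only [map_add, TensorProduct.add_tmul, hx, hy]
  | tmul x y => rfl

theorem coproduct_coassoc (x : ForestSpace d) :
    TensorProduct.assoc ℝ _ _ _ (coproduct.toLinearMap.rTensor (ForestSpace d) (coproduct x)) =
      coproduct.toLinearMap.lTensor (ForestSpace d) (coproduct x) := by
  have h : (Algebra.TensorProduct.assoc ℝ ℝ ℝ (ForestSpace d) (ForestSpace d)
        (ForestSpace d)).toAlgHom.comp
          ((Algebra.TensorProduct.map coproduct (AlgHom.id ℝ (ForestSpace d))).comp coproduct) =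
      (Algebra.TensorProduct.map (AlgHom.id ℝ (ForestSpace d)) coproduct).comp coproduct :=
    algHom_ext_graft fun i ζ ih => by
    change TensorProduct.assoc ℝ _ _ _ (coproduct.toLinearMap.rTensor _ (coproduct _)) =
      coproduct.toLinearMap.lTensor _ (coproduct _) at ih ⊢
    have hB : TensorProduct.assoc ℝ _ _ _ (coproduct.toLinearMap.rTensor (ForestSpace d)
        ((graftLin i).lTensor (ForestSpace d) (coproduct (basisForest ζ)))) =
      ((graftLin i).lTensor (ForestSpace d) ∘ₗ coproduct.toLinearMap).lTensor (ForestSpace d)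
        (coproduct (basisForest ζ)) := by
      rw [LinearMap.lTensor_comp, LinearMap.comp_apply, ← ih, ← LinearMap.comp_apply,
        LinearMap.rTensor_comp_lTensor, ← LinearMap.lTensor_comp_rTensor, LinearMap.comp_apply,
        LinearMap.lTensor_tensor]
      simp only [LinearMap.comp_apply, LinearEquiv.coe_coe, LinearEquiv.apply_symm_apply]
    rw [coproduct_graft, map_add, map_add, map_add, hB, LinearMap.rTensor_tmul,
      LinearMap.lTensor_tmul, ← LinearMap.comp_apply (LinearMap.lTensor _ coproduct.toLinearMap),
      ← LinearMap.lTensor_comp, coproduct_comp_graftLin, LinearMap.lTensor_add,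
      LinearMap.add_apply, ← assoc_lTensor_tmul, ← add_assoc, AlgHom.toLinearMap_apply,
      AlgHom.toLinearMap_apply, coproduct_graft, TensorProduct.add_tmul, map_add, map_one]
    rfl
  exact AlgHom.congr_fun h x

theorem leftAction_apply (g : Module.Dual ℝ (ForestSpace d)) (x : ForestSpace d) :
    leftAction g x = TensorProduct.lid ℝ _ (g.rTensor (ForestSpace d) (coproduct x)) := rfl

theorem convolution_apply (g h : Module.Dual ℝ (ForestSpace d)) (x : ForestSpace d) :
    convolution g h x = h (leftAction g x) := by
  have key : (TensorProduct.lid ℝ ℝ).toLinearMap ∘ₗ TensorProduct.map g h =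
      h ∘ₗ (TensorProduct.lid ℝ _).toLinearMap ∘ₗ g.rTensor (ForestSpace d) :=
    TensorProduct.ext' fun a b => by simp
  exact LinearMap.congr_fun key (coproduct x)

theorem counit_comp_leftAction (g : Module.Dual ℝ (ForestSpace d)) :
    counit ∘ₗ leftAction g = g := by
  have key : counit ∘ₗ (TensorProduct.lid ℝ _).toLinearMap ∘ₗ g.rTensor (ForestSpace d) =
      g ∘ₗ (TensorProduct.rid ℝ _).toLinearMap ∘ₗ counit.lTensor (ForestSpace d) :=
    TensorProduct.ext' fun a b => by simp [mul_comm]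
  refine LinearMap.ext fun x => (LinearMap.congr_fun key (coproduct x)).trans ?_
  simp [lTensor_counit_coproduct]

theorem leftAction_counit : leftAction (counit (d := d)) = LinearMap.id :=
  LinearMap.ext fun x => by
    rw [leftAction_apply, rTensor_counit_coproduct, TensorProduct.lid_tmul, one_smul,
      LinearMap.id_apply]

theorem leftAction_comp_leftAction (g h : Module.Dual ℝ (ForestSpace d)) :
    leftAction g ∘ₗ leftAction h = leftAction (convolution h g) := by
  have hleft : leftAction g ∘ₗ (TensorProduct.lid ℝ _).toLinearMap ∘ₗ h.rTensor (ForestSpace d) =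
      (TensorProduct.lid ℝ _).toLinearMap ∘ₗ g.rTensor (ForestSpace d) ∘ₗ
        (TensorProduct.lid ℝ _).toLinearMap ∘ₗ h.rTensor (ForestSpace d ⊗[ℝ] ForestSpace d) ∘ₗ
          coproduct.toLinearMap.lTensor (ForestSpace d) :=
    TensorProduct.ext' fun a b => by simp [leftAction_apply]
  have hright : (TensorProduct.lid ℝ _).toLinearMap ∘ₗ g.rTensor (ForestSpace d) ∘ₗ
        (TensorProduct.lid ℝ _).toLinearMap ∘ₗ h.rTensor (ForestSpace d ⊗[ℝ] ForestSpace d) ∘ₗ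
          (TensorProduct.assoc ℝ _ _ _).toLinearMap =
      (TensorProduct.lid ℝ _).toLinearMap ∘ₗ
        ((TensorProduct.lid ℝ ℝ).toLinearMap ∘ₗ TensorProduct.map h g).rTensor (ForestSpace d) :=
    TensorProduct.ext_threefold fun a b c => by simp [mul_smul]
  refine LinearMap.ext fun x => (LinearMap.congr_fun hleft (coproduct x)).trans ?_
  have hcoassoc := LinearMap.congr_fun hright (coproduct.toLinearMap.rTensor _ (coproduct x))
  simp only [LinearMap.comp_apply, LinearEquiv.coe_coe, coproduct_coassoc] at hcoassoc ⊢
  rw [hcoassoc, leftAction_apply,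
    ← LinearMap.comp_apply (LinearMap.rTensor _ _) (LinearMap.rTensor _ _),
    ← LinearMap.rTensor_comp]
  rfl

/-! ### Homogeneity -/

/-- The component of degree `n` of `⟨𝓕_d⟩ ⊗ ⟨𝓕_d⟩`, for the grading by the number of vertices. -/
def tensorLevel (d n : ℕ) : Submodule ℝ (ForestSpace d ⊗[ℝ] ForestSpace d) :=
  Submodule.span ℝ {z | ∃ a b : Forest (Fin d), a.size + b.size = n ∧
    basisForest a ⊗ₜ[ℝ] basisForest b = z}

theorem basisForest_tmul_mem_tensorLevel (a b : Forest (Fin d)) :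
    basisForest a ⊗ₜ[ℝ] basisForest b ∈ tensorLevel d (a.size + b.size) :=
  Submodule.subset_span ⟨a, b, rfl, rfl⟩

theorem mul_mem_tensorLevel {m n : ℕ} {y z : ForestSpace d ⊗[ℝ] ForestSpace d}
    (hy : y ∈ tensorLevel d m) (hz : z ∈ tensorLevel d n) : y * z ∈ tensorLevel d (m + n) := by
  have hyz := Submodule.mul_mem_mul hy hz
  rw [tensorLevel, tensorLevel, Submodule.span_mul_span] at hyz
  refine Submodule.span_mono ?_ hyz
  rintro _ ⟨_, ⟨a, b, rfl, rfl⟩, _, ⟨a', b', rfl, rfl⟩, rfl⟩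
  refine ⟨a * a', b * b', ?_, ?_⟩
  · rw [Forest.size_mul, Forest.size_mul, add_add_add_comm]
  · simp only [basisForest_mul, Algebra.TensorProduct.tmul_mul_tmul]

theorem lTensor_graftLin_mem_tensorLevel {n : ℕ} {z : ForestSpace d ⊗[ℝ] ForestSpace d}
    (hz : z ∈ tensorLevel d n) (i : Fin d) :
    (graftLin i).lTensor (ForestSpace d) z ∈ tensorLevel d (n + 1) := by
  have hmap := Submodule.mem_map_of_mem (f := (graftLin i).lTensor (ForestSpace d)) hz
  rw [tensorLevel, Submodule.map_span] at hmap
  refine Submodule.span_mono ?_ hmap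
  rintro _ ⟨_, ⟨a, b, rfl, rfl⟩, rfl⟩
  exact ⟨a, Forest.graft i b, by rw [Forest.size_graft, add_assoc], by
    rw [LinearMap.lTensor_tmul, graftLin_basisForest]⟩

theorem coproduct_mem_tensorLevel (ζ : Forest (Fin d)) :
    coproduct (basisForest ζ) ∈ tensorLevel d ζ.size := by
  induction ζ using Forest.induction with
  | one =>
    rw [basisForest_one, map_one]
    exact basisForest_tmul_mem_tensorLevel 1 1
  | graft_mul i a r iha ihr =>
    rw [basisForest_mul, map_mul, coproduct_graft, Forest.size_mul]
    refine mul_mem_tensorLevel (add_mem ?_ ?_) ihr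
    · exact basisForest_tmul_mem_tensorLevel (Forest.graft i a) 1
    · rw [Forest.size_graft]
      exact lTensor_graftLin_mem_tensorLevel iha i

/-- The functional that reads off the coefficient of a forest. -/
def coeffLin (ξ : Forest (Fin d)) : Module.Dual ℝ (ForestSpace d) :=
  Finsupp.lapply ξ ∘ₗ (MonoidAlgebra.coeffLinearEquiv ℝ).toLinearMap

theorem coeffLin_apply (ξ : Forest (Fin d)) (x : ForestSpace d) : coeffLin ξ x = x.coeff ξ := rfl

theorem coeffLin_basisForest_of_ne {ξ ζ : Forest (Fin d)} (h : ξ ≠ ζ) :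
    coeffLin ξ (basisForest ζ) = 0 := by
  rw [coeffLin_apply, MonoidAlgebra.coeff_single, Finsupp.single_eq_of_ne h]

theorem convolution_coeffLin (g : Module.Dual ℝ (ForestSpace d)) (ξ : Forest (Fin d))
    (x : ForestSpace d) : convolution g (coeffLin ξ) x = (leftAction g x).coeff ξ :=
  convolution_apply g (coeffLin ξ) x

theorem convolution_isBigO {ι : Type*} {l : Filter ι} {w : ι → ℝ}
    {g h : ι → Module.Dual ℝ (ForestSpace d)} (ζ : Forest (Fin d))
    (H : ∀ a b : Forest (Fin d), a.size + b.size = ζ.size →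
      (fun i => g i (basisForest a) * h i (basisForest b)) =O[l] w) :
    (fun i => convolution (g i) (h i) (basisForest ζ)) =O[l] w := by
  suffices key : ∀ z ∈ tensorLevel d ζ.size,
      (fun i => TensorProduct.lid ℝ ℝ (TensorProduct.map (g i) (h i) z)) =O[l] w from
    key _ (coproduct_mem_tensorLevel ζ)
  intro z hz
  induction hz using Submodule.span_induction with
  | mem z hz =>
    obtain ⟨a, b, hab, rfl⟩ := hz
    simpa only [TensorProduct.map_tmul, TensorProduct.lid_tmul, smul_eq_mul] using H a b hab
  | zero => simpa only [map_zero] using isBigO_zero w l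
  | add y z _ _ hy hz => simpa only [map_add] using hy.add hz
  | smul c z _ hz => simpa only [map_smul, smul_eq_mul] using hz.const_mul_left c

/-- The finite set of forests with `k` vertices. -/
def forestsOfSize (d k : ℕ) : Finset (Forest (Fin d)) := (Forest.finite_setOf_size_eq k).toFinset

@[simp] theorem mem_forestsOfSize {k : ℕ} {ζ : Forest (Fin d)} :
    ζ ∈ forestsOfSize d k ↔ ζ.size = k := by
  simp [forestsOfSize]

theorem forestNorm_nonneg (x : ForestSpace d) : 0 ≤ forestNorm x := Real.sqrt_nonneg _

theorem forestNorm_basisForest (ζ : Forest (Fin d)) : forestNorm (basisForest ζ) = 1 := by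
  simp [forestNorm]

theorem abs_coeff_le_forestNorm (x : ForestSpace d) (ζ : Forest (Fin d)) :
    |x.coeff ζ| ≤ forestNorm x := by
  by_cases h : ζ ∈ x.coeff.support
  · refine Real.abs_le_sqrt ?_
    exact Finset.single_le_sum (f := fun ζ => x.coeff ζ ^ 2) (fun _ _ => sq_nonneg _) h
  · rw [Finsupp.notMem_support_iff.1 h, abs_zero]
    exact forestNorm_nonneg x

theorem forestNorm_le_sum_abs {x : ForestSpace d} {S : Finset (Forest (Fin d))}
    (h : x.coeff.support ⊆ S) : forestNorm x ≤ ∑ ζ ∈ S, |x.coeff ζ| := by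
  refine Real.sqrt_le_iff.2 ⟨Finset.sum_nonneg fun _ _ => abs_nonneg _, ?_⟩
  rw [Finsupp.sum_of_support_subset _ h (fun _ c => c ^ 2) fun _ _ => zero_pow two_ne_zero]
  simpa only [sq_abs] using Finset.sum_sq_le_sq_sum_of_nonneg (s := S)
    (f := fun ζ => |x.coeff ζ|) fun _ _ => abs_nonneg _

theorem coeff_levelProj (k : ℕ) (x : ForestSpace d) (ζ : Forest (Fin d)) :
    (levelProj k x).coeff ζ = if ζ.size = k then x.coeff ζ else 0 := by
  classical exact Finsupp.filter_apply _ _ _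

theorem levelNorm_nonneg (k : ℕ) (x : ForestSpace d) : 0 ≤ levelNorm k x := forestNorm_nonneg _

theorem abs_coeff_le_levelNorm (x : ForestSpace d) (ζ : Forest (Fin d)) :
    |x.coeff ζ| ≤ levelNorm ζ.size x := by
  have h := abs_coeff_le_forestNorm (levelProj ζ.size x) ζ
  rwa [coeff_levelProj, if_pos rfl] at h

theorem levelNorm_le_sum_abs (k : ℕ) (x : ForestSpace d) :
    levelNorm k x ≤ ∑ ζ ∈ forestsOfSize d k, |x.coeff ζ| := by
  refine (forestNorm_le_sum_abs (S := forestsOfSize d k) fun ζ hζ => ?_).trans_eq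
    (Finset.sum_congr rfl fun ζ hζ => ?_)
  · rw [Finsupp.mem_support_iff, coeff_levelProj] at hζ
    exact mem_forestsOfSize.2 (by_contra fun h => hζ (if_neg h))
  · rw [coeff_levelProj, if_pos (mem_forestsOfSize.1 hζ)]

theorem basisForest_mem_level (ζ : Forest (Fin d)) : basisForest ζ ∈ level d ζ.size :=
  Submodule.subset_span ⟨ζ, rfl, rfl⟩

theorem eq_sum_of_mem_level {k : ℕ} {a : ForestSpace d} (ha : a ∈ level d k) :
    a = ∑ ζ ∈ forestsOfSize d k, a.coeff ζ • basisForest ζ := by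
  have h := LinearMap.eqOn_span (R := ℝ) (f := LinearMap.id)
    (g := ∑ ζ ∈ forestsOfSize d k, (coeffLin ζ).smulRight (basisForest ζ))
    (s := basisForest '' {ζ : Forest (Fin d) | ζ.size = k}) (by
      rintro _ ⟨ζ, hζ, rfl⟩
      rw [LinearMap.sum_apply, Finset.sum_eq_single_of_mem ζ (mem_forestsOfSize.2 hζ)]
      · simp [coeffLin_apply]
      · intro ξ _ hξ
        rw [LinearMap.smulRight_apply, coeffLin_basisForest_of_ne hξ, zero_smul])
  exact (h ha).trans (LinearMap.sum_apply _ _ _)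

theorem abs_le_of_mem_level (Φ : Module.Dual ℝ (ForestSpace d)) {k : ℕ} {a : ForestSpace d}
    (ha : a ∈ level d k) :
    |Φ a| ≤ (∑ ζ ∈ forestsOfSize d k, |Φ (basisForest ζ)|) * forestNorm a := by
  conv_lhs => rw [eq_sum_of_mem_level ha]
  rw [map_sum, Finset.sum_mul]
  refine (Finset.abs_sum_le_sum_abs _ _).trans (Finset.sum_le_sum fun ζ _ => ?_)
  rw [map_smul, smul_eq_mul, abs_mul, mul_comm]
  exact mul_le_mul_of_nonneg_left (abs_coeff_le_forestNorm a ζ) (abs_nonneg _)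

theorem isBigO_prod_level {ι : Type*} {l : Filter ι} {w : ι → ℝ}
    {Φ : ι → Module.Dual ℝ (ForestSpace d)} {k : ℕ}
    (h : ∀ ζ : Forest (Fin d), ζ.size = k → (fun i => Φ i (basisForest ζ)) =O[l] w) :
    (fun p : ι × ForestSpace d => Φ p.1 p.2) =O[l ×ˢ 𝓟 (level d k : Set (ForestSpace d))]
      fun p => w p.1 * forestNorm p.2 := by
  have hsum : (fun i => ∑ ζ ∈ forestsOfSize d k, |Φ i (basisForest ζ)|) =O[l] w :=
    IsBigO.fun_sum fun ζ hζ => (h ζ (mem_forestsOfSize.1 hζ)).abs_left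
  refine IsBigO.trans ?_ ((hsum.comp_tendsto tendsto_fst).mul (isBigO_refl _ _))
  exact .of_norm_eventuallyLE <| eventually_prod_principal_iff.2 <| .of_forall fun i _ ha =>
    abs_le_of_mem_level (Φ i) ha

theorem levelNorm_isBigO_prod_level {ι : Type*} {l : Filter ι} {w : ι → ℝ}
    {A : ι → ForestSpace d →ₗ[ℝ] ForestSpace d} {k m : ℕ}
    (h : ∀ ζ ξ : Forest (Fin d), ζ.size = k → ξ.size = m →
      (fun i => (A i (basisForest ζ)).coeff ξ) =O[l] w) :
    (fun p : ι × ForestSpace d => levelNorm m (A p.1 p.2))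
      =O[l ×ˢ 𝓟 (level d k : Set (ForestSpace d))] fun p => w p.1 * forestNorm p.2 := by
  have hsum : (fun p : ι × ForestSpace d => ∑ ξ ∈ forestsOfSize d m, |(A p.1 p.2).coeff ξ|)
      =O[l ×ˢ 𝓟 (level d k : Set (ForestSpace d))] fun p => w p.1 * forestNorm p.2 :=
    IsBigO.fun_sum fun ξ hξ => (isBigO_prod_level (Φ := fun i => coeffLin ξ ∘ₗ A i) fun ζ hζ =>
      h ζ ξ hζ (mem_forestsOfSize.1 hξ)).abs_left
  refine IsBigO.trans (.of_norm_le fun p => ?_) hsum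
  rw [Real.norm_of_nonneg (levelNorm_nonneg _ _)]
  exact levelNorm_le_sum_abs m _

/-! ### Distributions of positive order vanish -/

section Schwartz

variable {E F : Type*} [NormedAddCommGroup E] [NormedSpace ℝ E] [NormedAddCommGroup F]
  [NormedSpace ℝ F]

theorem seminorm_le_of_eqOn_ball {f : 𝓢(E, F)} {R : ℝ} (hR : 0 < R)
    (hf : Set.EqOn f 0 (Metric.ball 0 R)) (k l : ℕ) :
    SchwartzMap.seminorm ℝ k l f ≤ R⁻¹ * SchwartzMap.seminorm ℝ (k + 1) l f := by
  refine SchwartzMap.seminorm_le_bound ℝ k l f (by positivity) fun x => ?_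
  by_cases hx : x ∈ Metric.ball (0 : E) R
  · have hzero : f =ᶠ[𝓝 x] 0 := hf.eventuallyEq_of_mem (Metric.isOpen_ball.mem_nhds hx)
    have hderiv : iteratedFDeriv ℝ l f x = 0 := by
      simpa using (hzero.iteratedFDeriv ℝ l).self_of_nhds
    rw [hderiv, norm_zero, mul_zero]
    positivity
  · have hRx : R ≤ ‖x‖ := by simpa using hx
    calc ‖x‖ ^ k * ‖iteratedFDeriv ℝ l f x‖
        ≤ R⁻¹ * ‖x‖ * (‖x‖ ^ k * ‖iteratedFDeriv ℝ l f x‖) :=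
          le_mul_of_one_le_left (by positivity) ((one_le_inv_mul₀ hR).2 hRx)
      _ = R⁻¹ * (‖x‖ ^ (k + 1) * ‖iteratedFDeriv ℝ l f x‖) := by ring
      _ ≤ R⁻¹ * SchwartzMap.seminorm ℝ (k + 1) l f := by
          gcongr
          exact SchwartzMap.le_seminorm ℝ (k + 1) l f x

theorem hasTemperateGrowth_comp_add_smul (c : 𝓢(E, ℝ)) (a : E) (r : ℝ) :
    Function.HasTemperateGrowth fun x => c (a + r • x) := by
  have := c.hasTemperateGrowth
  fun_prop

theorem norm_iteratedFDeriv_comp_add_smul_le (c : 𝓢(E, ℝ)) (a : E) {r : ℝ} (hr : |r| ≤ 1)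
    (i : ℕ) (x : E) :
    ‖iteratedFDeriv ℝ i (fun y => c (a + r • y)) x‖ ≤ SchwartzMap.seminorm ℝ 0 i c := by
  have hc : ContDiff ℝ i fun y => c (a + y) := (c.smooth i).comp (contDiff_const.add contDiff_id)
  rw [iteratedFDeriv_comp_const_smul r hc, iteratedFDeriv_comp_add_left', norm_smul, norm_pow]
  exact (mul_le_of_le_one_left (norm_nonneg _) (pow_le_one₀ (norm_nonneg r) hr)).trans
    (SchwartzMap.norm_iteratedFDeriv_le_seminorm ℝ c i (a + r • x))

theorem exists_seminorm_smulLeftCLM_le (c : 𝓢(E, ℝ)) (u : 𝓢(E, F)) (k l : ℕ) :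
    ∃ C, ∀ (a : E) (r : ℝ), |r| ≤ 1 →
      SchwartzMap.seminorm ℝ k l (SchwartzMap.smulLeftCLM F (fun x => c (a + r • x)) u) ≤ C := by
  let C := ∑ i ∈ Finset.range (l + 1),
    l.choose i * SchwartzMap.seminorm ℝ 0 i c * SchwartzMap.seminorm ℝ k (l - i) u
  refine ⟨C, fun a r hr => SchwartzMap.seminorm_le_bound ℝ k l _ (by positivity) fun x => ?_⟩
  have hcr := hasTemperateGrowth_comp_add_smul c a r
  rw [SchwartzMap.smulLeftCLM_apply hcr]
  refine (mul_le_mul_of_nonneg_left (norm_iteratedFDeriv_smul_le (hcr.1.of_le (mod_cast le_top))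
    (u.smooth l) x le_rfl) (by positivity)).trans ?_
  rw [Finset.mul_sum]
  refine Finset.sum_le_sum fun i _ => ?_
  calc _ = l.choose i * ‖iteratedFDeriv ℝ i (fun y => c (a + r • y)) x‖ *
        (‖x‖ ^ k * ‖iteratedFDeriv ℝ (l - i) u x‖) := by ring
    _ ≤ _ := by
      gcongr
      · exact norm_iteratedFDeriv_comp_add_smul_le c a hr i x
      · exact SchwartzMap.le_seminorm ℝ k (l - i) u x

/-- Cutting off at radius `R` changes `u` only outside a ball of radius `R`, where one spare power
of `‖x‖` gains a factor `R⁻¹` in every seminorm. -/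
theorem dense_hasCompactSupport [FiniteDimensional ℝ E] :
    Dense {u : 𝓢(E, F) | HasCompactSupport u} := by
  intro u
  let b : ContDiffBump (0 : E) := ⟨1, 2, one_pos, one_lt_two⟩
  let c : 𝓢(E, ℝ) := b.hasCompactSupport.toSchwartzMap b.contDiff
  let r : ℕ → ℝ := fun n => (n + 1 : ℝ)⁻¹
  have hr : ∀ n, |r n| ≤ 1 := fun n => by
    rw [abs_of_pos (by positivity)]
    exact inv_le_one_of_one_le₀ (by simp)
  let v : ℕ → 𝓢(E, F) := fun n => SchwartzMap.smulLeftCLM F (fun x => c (0 + r n • x)) u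
  have hv : ∀ n x, v n x = b (r n • x) • u x := fun n x => by
    have := SchwartzMap.smulLeftCLM_apply_apply (hasTemperateGrowth_comp_add_smul c 0 (r n)) u x
    rwa [zero_add] at this
  refine mem_closure_of_tendsto (f := v) (b := atTop)
    (((schwartz_withSeminorms ℝ E F).tendsto_nhds _ _).2 ?_) (.of_forall fun n => ?_)
  · rintro ⟨k, l⟩ ε hε
    obtain ⟨C, hC⟩ := exists_seminorm_smulLeftCLM_le c u (k + 1) l
    have hbound : ∀ n, SchwartzMap.seminorm ℝ k l (v n - u) ≤
        r n * (C + SchwartzMap.seminorm ℝ (k + 1) l u) := fun n => by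
      have hvu : Set.EqOn (v n - u) 0 (Metric.ball 0 (n + 1)) := fun x hx => by
        have hx' : r n • x ∈ Metric.closedBall (0 : E) 1 := by
          rw [mem_ball_zero_iff] at hx
          rw [mem_closedBall_zero_iff, norm_smul, Real.norm_of_nonneg (by positivity)]
          exact inv_mul_le_one_of_le₀ hx.le (by positivity)
        simp [hv, b.one_of_mem_closedBall hx']
      refine (seminorm_le_of_eqOn_ball (by positivity) hvu k l).trans ?_
      gcongr
      exact (map_sub_le_add _ _ _).trans (add_le_add_left (hC 0 _ (hr n)) _)
    have hlim : Tendsto (fun n => r n * (C + SchwartzMap.seminorm ℝ (k + 1) l u)) atTop (𝓝 0) := by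
      simpa [r, one_div] using (tendsto_one_div_add_atTop_nhds_zero_nat (𝕜 := ℝ)).mul_const
        (C + SchwartzMap.seminorm ℝ (k + 1) l u)
    filter_upwards [hlim.eventually (gt_mem_nhds hε)] with n hn using (hbound n).trans_lt hn
  · have hb : HasCompactSupport fun x => b (r n • x) :=
      b.hasCompactSupport.comp_homeomorph (Homeomorph.smulOfNeZero (r n) (by positivity))
    rw [mem_ofPred_eq, funext (hv n)]
    exact hb.smul_right

theorem Tempered.eq_zero_of_hasCompactSupport {η : Tempered}
    (h : ∀ u : 𝓢(ℝ, ℝ), HasCompactSupport u → η u = 0) : η = 0 :=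
  ContinuousLinearMap.ext fun u => congrFun
    (η.continuous.ext_on dense_hasCompactSupport continuous_const h) u

end Schwartz

/-- A smooth bump whose integer translates form a partition of unity. -/
def unitBump (y : ℝ) : ℝ :=
  Real.smoothTransition (2 * (y + 3 / 4)) - Real.smoothTransition (2 * (y - 1 / 4))

theorem contDiff_unitBump {n : ℕ∞} : ContDiff ℝ n unitBump :=
  (Real.smoothTransition.contDiff.comp (contDiff_const.mul (contDiff_id.add contDiff_const))).sub
    (Real.smoothTransition.contDiff.comp (contDiff_const.mul (contDiff_id.sub contDiff_const)))

theorem unitBump_eq_zero {y : ℝ} (h : 3 / 4 ≤ |y|) : unitBump y = 0 := by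
  rcases le_abs.1 h with h | h
  · rw [unitBump, Real.smoothTransition.one_of_one_le (by linarith),
      Real.smoothTransition.one_of_one_le (by linarith), sub_self]
  · rw [unitBump, Real.smoothTransition.zero_of_nonpos (by linarith),
      Real.smoothTransition.zero_of_nonpos (by linarith), sub_self]

theorem tsupport_unitBump_subset : tsupport unitBump ⊆ Metric.closedBall 0 (3 / 4) := by
  refine closure_minimal (fun z hz => ?_) Metric.isClosed_closedBall
  rw [mem_closedBall_zero_iff]
  exact le_of_not_gt fun h => hz (unitBump_eq_zero h.le)

theorem hasCompactSupport_unitBump : HasCompactSupport unitBump :=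
  (isCompact_closedBall _ _).of_isClosed_subset (isClosed_tsupport _) tsupport_unitBump_subset

theorem sum_unitBump {N : ℕ} {y : ℝ} (h : |y| ≤ N) :
    ∑ j ∈ Finset.range (2 * N + 1), unitBump (y - (j - N)) = 1 := by
  have hy := abs_le.1 h
  have htelescope : ∀ j : ℕ, unitBump (y - (j - N)) =
      Real.smoothTransition (2 * (y + N - j + 3 / 4)) -
        Real.smoothTransition (2 * (y + N - (j + 1 : ℕ) + 3 / 4)) := fun j => by
    rw [unitBump]
    push_cast
    congr 2 <;> ring
  rw [Finset.sum_congr rfl fun j _ => htelescope j, Finset.sum_range_sub',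
    Real.smoothTransition.one_of_one_le, Real.smoothTransition.zero_of_nonpos, sub_zero] <;>
  · push_cast
    linarith

/-- The piece of `u` cut out by `unitBump` around `r` at scale `δ`, in rescaled coordinates. -/
def localized (u : 𝓢(ℝ, ℝ)) (r δ : ℝ) : 𝓢(ℝ, ℝ) :=
  SchwartzMap.smulLeftCLM ℝ (fun z => u (r + δ • z))
    (hasCompactSupport_unitBump.toSchwartzMap contDiff_unitBump)

theorem localized_apply (u : 𝓢(ℝ, ℝ)) (r δ z : ℝ) :
    localized u r δ z = u (r + δ * z) * unitBump z :=
  SchwartzMap.smulLeftCLM_apply_apply (hasTemperateGrowth_comp_add_smul u r δ) _ z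

theorem tsupport_localized_subset (u : 𝓢(ℝ, ℝ)) (r δ : ℝ) :
    tsupport (localized u r δ) ⊆ Metric.ball 0 1 :=
  calc tsupport (localized u r δ) = tsupport fun z => u (r + δ * z) * unitBump z := by
        rw [funext (localized_apply u r δ)]
    _ ⊆ tsupport unitBump := tsupport_mul_subset_right
    _ ⊆ Metric.ball 0 1 :=
        tsupport_unitBump_subset.trans (Metric.closedBall_subset_ball (by norm_num))

theorem inv_smul_mem_testFunctions {w : 𝓢(ℝ, ℝ)} {M : ℝ} (hM : 0 < M)
    (hw : tsupport w ⊆ Metric.ball 0 1) (h₀ : SchwartzMap.seminorm ℝ 0 0 w ≤ M)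
    (h₁ : SchwartzMap.seminorm ℝ 0 1 w ≤ M) : M⁻¹ • w ∈ testFunctions := by
  have hscale : ∀ x : ℝ, |x| ≤ M → |M⁻¹ * x| ≤ 1 := fun x hx => by
    rwa [abs_mul, abs_of_pos (inv_pos.2 hM), inv_mul_le_one₀ hM]
  refine ⟨(tsupport_smul_subset_right (fun _ => M⁻¹) w).trans hw, fun y => ⟨?_, ?_⟩⟩
  · exact hscale _ ((SchwartzMap.norm_le_seminorm ℝ w y).trans h₀)
  · have hderiv : |deriv w y| ≤ SchwartzMap.seminorm ℝ 0 1 w := by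
      simpa [norm_iteratedFDeriv_eq_norm_iteratedDeriv] using
        SchwartzMap.norm_iteratedFDeriv_le_seminorm ℝ w 1 y
    rw [FunLike.coe_smul, deriv_const_smul _ w.differentiableAt]
    exact hscale _ (hderiv.trans h₁)

theorem exists_inv_smul_localized_mem_testFunctions (u : 𝓢(ℝ, ℝ)) :
    ∃ M : ℝ, 0 < M ∧ ∀ r δ : ℝ, |δ| ≤ 1 → M⁻¹ • localized u r δ ∈ testFunctions := by
  obtain ⟨C₀, h₀⟩ := exists_seminorm_smulLeftCLM_le u
    (hasCompactSupport_unitBump.toSchwartzMap contDiff_unitBump) 0 0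
  obtain ⟨C₁, h₁⟩ := exists_seminorm_smulLeftCLM_le u
    (hasCompactSupport_unitBump.toSchwartzMap contDiff_unitBump) 0 1
  refine ⟨max 1 (max C₀ C₁), by positivity, fun r δ hδ => ?_⟩
  exact inv_smul_mem_testFunctions (by positivity) (tsupport_localized_subset u r δ)
    ((h₀ r δ hδ).trans (by simp)) ((h₁ r δ hδ).trans (by simp))

theorem sum_rescale_localized {u : 𝓢(ℝ, ℝ)} {N : ℕ} {δ : ℝ} (hδ : 0 < δ)
    (hu : ∀ y, δ * N < |y| → u y = 0) :
    ∑ j ∈ Finset.range (2 * N + 1),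
      δ • rescale (δ * (j - N)) δ hδ.ne' (localized u (δ * (j - N)) δ) = u := by
  ext y
  have hterm : ∀ j : ℕ,
      (δ • rescale (δ * (j - N)) δ hδ.ne' (localized u (δ * (j - N)) δ)) y =
        u y * unitBump (δ⁻¹ * y - (j - N)) := fun j => by
    have harg : δ⁻¹ * (y - δ * (j - N)) = δ⁻¹ * y - (j - N) := by field_simp
    have hpoint : δ * (j - N) + δ * (δ⁻¹ * y - (j - N)) = y := by field_simp; ring
    rw [_root_.smul_apply, rescale_apply, localized_apply, harg, hpoint, smul_eq_mul,
      mul_inv_cancel_left₀ hδ.ne']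
  rw [_root_.sum_apply, Finset.sum_congr rfl fun j _ => hterm j, ← Finset.mul_sum]
  by_cases hy : δ * N < |y|
  · rw [hu y hy, zero_mul]
  · rw [sum_unitBump, mul_one]
    rwa [abs_mul, abs_of_pos (inv_pos.2 hδ), inv_mul_le_iff₀ hδ, ← not_lt]

/-- A test function together with the centre and the scale, in `(0, 1]`, to which it is moved. -/
structure Probe where
  center : ℝ
  scale : ℝ
  scale_pos : 0 < scale
  scale_le_one : scale ≤ 1
  profile : 𝓢(ℝ, ℝ)
  profile_mem : profile ∈ testFunctions

/-- The Schwartz function `y ↦ δ⁻¹ u (δ⁻¹ (y - s))` of a probe with profile `u`, centre `s` and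
scale `δ`. -/
def Probe.test (q : Probe) : 𝓢(ℝ, ℝ) := rescale q.center q.scale q.scale_pos.ne' q.profile

theorem Tempered.abs_le_of_probe_bound {η : Tempered} {C M γ : ℝ} {R : ℕ} (hC : 0 ≤ C)
    (hη : ∀ q : Probe, q.center ∈ Icc (-R : ℝ) R → |η q.test| ≤ C * q.scale ^ γ)
    {u : 𝓢(ℝ, ℝ)} (hu : ∀ y, (R : ℝ) < |y| → u y = 0) (hM : 0 < M)
    (hloc : ∀ r δ : ℝ, |δ| ≤ 1 → M⁻¹ • localized u r δ ∈ testFunctions) (n : ℕ) :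
    |η u| ≤ (2 * R + 1) * M * C * ((n + 1 : ℝ)⁻¹) ^ γ := by
  set δ : ℝ := (n + 1 : ℝ)⁻¹ with hδ_def
  set N : ℕ := (n + 1) * R with hN_def
  have hδ : 0 < δ := by positivity
  have hδ1 : δ ≤ 1 := inv_le_one_of_one_le₀ (by simp)
  have hδN : δ * N = R := by
    rw [hN_def, hδ_def]
    push_cast
    field_simp
  have hterm : ∀ j ∈ Finset.range (2 * N + 1),
      |η (δ • rescale (δ * (j - N)) δ hδ.ne' (localized u (δ * (j - N)) δ))| ≤
        δ * (M * (C * δ ^ γ)) := fun j hj => by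
    have hj : (j : ℝ) ≤ 2 * N := by exact_mod_cast Nat.lt_succ_iff.1 (Finset.mem_range.1 hj)
    let q : Probe := ⟨δ * (j - N), δ, hδ, hδ1, _, hloc (δ * (j - N)) δ (by rwa [abs_of_pos hδ])⟩
    have hq : q.center ∈ Icc (-R : ℝ) R := by
      rw [← hδN, ← mul_neg]
      constructor <;> refine mul_le_mul_of_nonneg_left ?_ hδ.le <;> grind
    have hqu : M • q.test = rescale (δ * (j - N)) δ hδ.ne' (localized u (δ * (j - N)) δ) := by
      ext y
      simp only [q, Probe.test, rescale_apply, _root_.smul_apply, smul_eq_mul]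
      field_simp
    rw [← hqu, map_smul, map_smul, smul_eq_mul, smul_eq_mul, abs_mul, abs_mul, abs_of_pos hδ,
      abs_of_pos hM]
    gcongr
    exact hη q hq
  calc |η u| = |∑ j ∈ Finset.range (2 * N + 1),
        η (δ • rescale (δ * (j - N)) δ hδ.ne' (localized u (δ * (j - N)) δ))| := by
        rw [← map_sum, sum_rescale_localized hδ (by rwa [hδN])]
    _ ≤ ∑ _j ∈ Finset.range (2 * N + 1), δ * (M * (C * δ ^ γ)) :=
        (Finset.abs_sum_le_sum_abs _ _).trans (Finset.sum_le_sum hterm)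
    _ = (2 * (δ * N) + δ) * M * C * δ ^ γ := by
        rw [Finset.sum_const, Finset.card_range, nsmul_eq_mul]
        push_cast
        ring
    _ ≤ (2 * R + 1) * M * C * δ ^ γ := by
        rw [hδN]
        gcongr

/-- A partition of unity at scale `δ` writes a compactly supported function as `O(δ⁻¹)` probes of
scale `δ`, each with a weight `O(δ)`. -/
theorem Tempered.eq_zero_of_isBigO {η : Tempered} {γ : ℝ} (hγ : 0 < γ)
    (hη : ∀ K : Set ℝ, IsCompact K →
      (fun q : Probe => η q.test) =O[𝓟 {q | q.center ∈ K}] fun q => q.scale ^ γ) : η = 0 := by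
  refine Tempered.eq_zero_of_hasCompactSupport fun u hu => ?_
  obtain ⟨R, hR⟩ : ∃ R : ℕ, ∀ y, (R : ℝ) < |y| → u y = 0 := by
    obtain ⟨r, hr⟩ := hu.isBounded.subset_closedBall (0 : ℝ)
    obtain ⟨R, hrR⟩ := exists_nat_ge r
    refine ⟨R, fun y hy => image_eq_zero_of_notMem_tsupport fun hy' => ?_⟩
    have := mem_closedBall_zero_iff.1 (hr hy')
    rw [Real.norm_eq_abs] at this
    linarith
  obtain ⟨C, hC0, hC⟩ := (hη (Icc (-R) R) isCompact_Icc).exists_nonneg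
  obtain ⟨M, hM, hloc⟩ := exists_inv_smul_localized_mem_testFunctions u
  have hbound : ∀ q : Probe, q.center ∈ Icc (-R : ℝ) R → |η q.test| ≤ C * q.scale ^ γ :=
    fun q hq => by
      have := isBigOWith_principal.1 hC q hq
      rwa [Real.norm_of_nonneg (Real.rpow_nonneg q.scale_pos.le γ)] at this
  have hlim : Tendsto (fun n : ℕ => (2 * R + 1) * M * C * ((n + 1 : ℝ)⁻¹) ^ γ) atTop (𝓝 0) := by
    have hinv : Tendsto (fun n : ℕ => (n + 1 : ℝ)⁻¹) atTop (𝓝 0) := by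
      simpa [one_div] using tendsto_one_div_add_atTop_nhds_zero_nat (𝕜 := ℝ)
    have := (hinv.rpow_const (p := γ) (Or.inr hγ.le)).const_mul ((2 * R + 1) * M * C)
    rwa [Real.zero_rpow hγ.ne', mul_zero] at this
  exact abs_nonpos_iff.1 (ge_of_tendsto' hlim
    (Tempered.abs_le_of_probe_bound hC0 hbound hR hM hloc))

/-! ### Rough paths and bimaps on the line -/

/-- A `γ`-Hölder branched rough path with parameters in all of `ℝ`, locally uniform in the
parameters: the common form of a branched rough path on an interval, extended by constants, and of
the second component of a model. -/
structure IsLineRoughPath (γ : ℝ) (Y : ℝ → ℝ → Module.Dual ℝ (ForestSpace d)) : Prop where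
  exists_char : ∀ s t, ∃ g : ForestSpace d →ₐ[ℝ] ℝ, g.toLinearMap = Y s t
  diag : ∀ t, Y t t = counit
  chen : ∀ s u t, convolution (Y s u) (Y u t) = Y s t
  holder : ∀ K : Set ℝ, IsCompact K → ∀ ζ : Forest (Fin d),
    (fun p : ℝ × ℝ => Y p.1 p.2 (basisForest ζ)) =O[𝓟 (K ×ˢ K)]
      fun p => |p.2 - p.1| ^ (γ * (ζ.size : ℝ))

namespace IsLineRoughPath

variable {γ T : ℝ} {Y : ℝ → ℝ → Module.Dual ℝ (ForestSpace d)}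

theorem map_one (hY : IsLineRoughPath γ Y) (s t : ℝ) : Y s t 1 = 1 := by
  obtain ⟨g, hg⟩ := hY.exists_char s t
  rw [← hg, AlgHom.toLinearMap_apply, _root_.map_one]

theorem map_mul (hY : IsLineRoughPath γ Y) (s t : ℝ) (x y : ForestSpace d) :
    Y s t (x * y) = Y s t x * Y s t y := by
  obtain ⟨g, hg⟩ := hY.exists_char s t
  simp only [← hg, AlgHom.toLinearMap_apply, _root_.map_mul]

theorem apply_leftAction (hY : IsLineRoughPath γ Y) (s u t : ℝ) (x : ForestSpace d) :
    Y u t (leftAction (Y s u) x) = Y s t x := by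
  rw [← convolution_apply, hY.chen]

theorem isBranchedRoughPath (hY : IsLineRoughPath γ Y) :
    IsBranchedRoughPath γ T fun s t => Y s t where
  map_one s t := hY.map_one s t
  map_mul s t _ _ := hY.map_mul s t _ _
  diag t := hY.diag t
  chen s u t _ := by rw [hY.chen]
  holder ζ := by
    obtain ⟨C, hC⟩ := (hY.holder (Icc 0 T) isCompact_Icc ζ).bound
    refine ⟨C, fun s t hst => ?_⟩
    have hpos : 0 < |(t : ℝ) - s| := abs_pos.2 (sub_ne_zero.2 (Subtype.coe_injective.ne hst.symm))
    have h : |Y s t (basisForest ζ)| ≤ C * ‖|(t : ℝ) - s| ^ (γ * (ζ.size : ℝ))‖ :=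
      eventually_principal.1 hC (s, t) ⟨s.2, t.2⟩
    rw [Real.norm_of_nonneg (by positivity)] at h
    exact (div_le_iff₀ (by positivity)).2 h

theorem isBigO_coeff_leftAction (hY : IsLineRoughPath γ Y) {K : Set ℝ} (hK : IsCompact K)
    (ζ ξ : Forest (Fin d)) :
    (fun p : ℝ × ℝ => (leftAction (Y p.2 p.1) (basisForest ζ)).coeff ξ) =O[𝓟 (K ×ˢ K)]
      fun p => |p.1 - p.2| ^ (γ * (ζ.size : ℝ) - γ * (ξ.size : ℝ)) := by
  simp only [← convolution_coeffLin]
  refine convolution_isBigO ζ fun a b hab => ?_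
  by_cases hb : b = ξ
  · subst hb
    have hexp : γ * (ζ.size : ℝ) - γ * (b.size : ℝ) = γ * (a.size : ℝ) := by
      rw [← hab]
      push_cast
      ring
    have hswap : Tendsto Prod.swap (𝓟 (K ×ˢ K)) (𝓟 (K ×ˢ K)) :=
      tendsto_principal_principal.2 fun _ h => h.symm
    simpa only [coeffLin_apply, MonoidAlgebra.coeff_single, Finsupp.single_eq_same, mul_one,
      hexp, Function.comp_def, Prod.fst_swap, Prod.snd_swap] using
      (hY.holder K hK a).comp_tendsto hswap
  · simpa only [coeffLin_basisForest_of_ne (Ne.symm hb), mul_zero] using isBigO_zero _ _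

theorem isBimap (hY : IsLineRoughPath γ Y) : IsBimap γ fun s t => leftAction (Y t s) where
  mem s t := (hY.exists_char t s).imp fun _ hg => by rw [hg]
  diag s := by rw [hY.diag, leftAction_counit]
  comp s u t := by rw [leftAction_comp_leftAction, hY.chen]
  bound K hK k := by
    have hlevel : ∀ m, ∃ C : ℝ, 0 ≤ C ∧ ∀ s ∈ K, ∀ t ∈ K, ∀ a ∈ level d k,
        levelNorm m (leftAction (Y t s) a) ≤
          C * (|s - t| ^ (γ * (k : ℝ) - γ * (m : ℝ)) * forestNorm a) := fun m => by
      obtain ⟨C, hC0, hC⟩ := (levelNorm_isBigO_prod_level (k := k) (m := m)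
        (A := fun p : ℝ × ℝ => leftAction (Y p.2 p.1))
        (w := fun p => |p.1 - p.2| ^ (γ * (k : ℝ) - γ * (m : ℝ))) fun ζ ξ hζ hξ => by
          subst hζ hξ
          exact hY.isBigO_coeff_leftAction hK ζ ξ).exists_nonneg
      rw [prod_principal_principal, isBigOWith_principal] at hC
      refine ⟨C, hC0, fun s hs t ht a ha => ?_⟩
      have h := hC ((s, t), a) ⟨⟨hs, ht⟩, ha⟩
      rwa [Real.norm_of_nonneg (levelNorm_nonneg _ _), Real.norm_of_nonneg
        (mul_nonneg (by positivity) (forestNorm_nonneg a))] at h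
    choose C hC0 hC using hlevel
    refine ⟨∑ m ∈ Finset.range k, C m, fun s hs t ht a ha m hm => ?_⟩
    calc levelNorm m (leftAction (Y t s) a)
        ≤ C m * (|s - t| ^ (γ * (k : ℝ) - γ * (m : ℝ)) * forestNorm a) := hC m s hs t ht a ha
      _ ≤ (∑ m ∈ Finset.range k, C m) *
          (|s - t| ^ (γ * (k : ℝ) - γ * (m : ℝ)) * forestNorm a) := by
        have := forestNorm_nonneg a
        gcongr
        exact Finset.single_le_sum (fun m _ => hC0 m) (Finset.mem_range.2 hm)
      _ = _ := by ring

theorem tendsto_nhds_counit (hY : IsLineRoughPath γ Y) (hγ : 0 < γ) (t : ℝ) (x : ForestSpace d) :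
    Tendsto (fun r => Y t r x) (𝓝 t) (𝓝 (counit x)) := by
  induction x using MonoidAlgebra.induction_linear with
  | zero => simp only [map_zero, tendsto_const_nhds]
  | add x y hx hy => simpa only [map_add] using hx.add hy
  | single ζ c =>
    rw [← mul_one c, ← smul_eq_mul, ← MonoidAlgebra.smul_single]
    simp only [map_smul]
    refine Tendsto.const_smul ?_ c
    by_cases hζ : ζ = 1
    · subst hζ
      simp only [basisForest_one, counit_one, hY.map_one, tendsto_const_nhds]
    · rw [counit_basisForest_of_ne_one hζ]
      have hexp : 0 < γ * (ζ.size : ℝ) :=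
        mul_pos hγ (Nat.cast_pos.2 (Nat.pos_of_ne_zero (mt Forest.size_eq_zero.1 hζ)))
      have hball : Tendsto (fun r => (t, r)) (𝓝 t)
          (𝓟 (Metric.closedBall t 1 ×ˢ Metric.closedBall t 1)) :=
        tendsto_principal.2 <| mem_of_superset (Metric.closedBall_mem_nhds t one_pos)
          fun r hr => ⟨Metric.mem_closedBall_self zero_le_one, hr⟩
      have hlim : Tendsto (fun r => |r - t| ^ (γ * (ζ.size : ℝ))) (𝓝 t) (𝓝 0) := by
        have hcont : Continuous fun r => |r - t| ^ (γ * (ζ.size : ℝ)) :=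
          (by fun_prop : Continuous fun r => |r - t|).rpow_const fun _ => Or.inr hexp.le
        simpa only [sub_self, abs_zero, Real.zero_rpow hexp.ne'] using hcont.tendsto t
      exact ((hY.holder _ (isCompact_closedBall t 1) ζ).comp_tendsto hball).trans_tendsto hlim

theorem continuous_right (hY : IsLineRoughPath γ Y) (hγ : 0 < γ) (s : ℝ) (x : ForestSpace d) :
    Continuous fun t => Y s t x := by
  refine continuous_iff_continuousAt.2 fun t => ?_
  have h := hY.tendsto_nhds_counit hγ t (leftAction (Y s t) x)
  rwa [← LinearMap.comp_apply, counit_comp_leftAction, funext fun r => hY.apply_leftAction s t r x]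
    at h

end IsLineRoughPath

namespace IsBranchedRoughPath

variable {γ T : ℝ} {X : Icc (0 : ℝ) T → Icc (0 : ℝ) T → Module.Dual ℝ (ForestSpace d)}

theorem exists_char (hX : IsBranchedRoughPath γ T X) (s t : Icc (0 : ℝ) T) :
    ∃ g : ForestSpace d →ₐ[ℝ] ℝ, g.toLinearMap = X s t :=
  ⟨MonoidAlgebra.lift ℝ ℝ (Forest (Fin d))
    { toFun := fun ζ => X s t (basisForest ζ)
      map_one' := hX.map_one s t
      map_mul' := fun a b => by rw [basisForest_mul, hX.map_mul] },
    linearMap_ext fun _ => (MonoidAlgebra.lift_single _ _ _).trans (one_smul _ _)⟩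

theorem exists_holder_projIcc (hX : IsBranchedRoughPath γ T X) (hγ : 0 ≤ γ) (hT : 0 ≤ T)
    {ζ : Forest (Fin d)} (hζ : ζ ≠ 1) : ∃ C, ∀ s t : ℝ,
      |X (projIcc 0 T hT s) (projIcc 0 T hT t) (basisForest ζ)| ≤
        C * |t - s| ^ (γ * (ζ.size : ℝ)) := by
  obtain ⟨C, hC⟩ := hX.holder ζ
  refine ⟨|C|, fun s t => ?_⟩
  set p := projIcc 0 T hT
  by_cases hst : p s = p t
  · rw [hst, hX.diag, counit_basisForest_of_ne_one hζ, abs_zero]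
    positivity
  · have hpos : 0 < |(p t : ℝ) - p s| :=
      abs_pos.2 (sub_ne_zero.2 (Subtype.coe_injective.ne (Ne.symm hst)))
    calc |X (p s) (p t) (basisForest ζ)|
        ≤ C * |(p t : ℝ) - p s| ^ (γ * (ζ.size : ℝ)) :=
          (div_le_iff₀ (by positivity)).1 (hC _ _ hst)
      _ ≤ |C| * |t - s| ^ (γ * (ζ.size : ℝ)) := by
        have hproj : |(p t : ℝ) - p s| ≤ |t - s| := abs_projIcc_sub_projIcc hT
        gcongr ?_ * ?_ ^ _
        exact le_abs_self C

theorem isLineRoughPath_projIcc (hX : IsBranchedRoughPath γ T X) (hγ : 0 ≤ γ) (hT : 0 ≤ T) :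
    IsLineRoughPath γ fun s t => X (projIcc 0 T hT s) (projIcc 0 T hT t) where
  exists_char _ _ := hX.exists_char _ _
  diag _ := hX.diag _
  chen _ _ _ := linearMap_ext fun ζ => (hX.chen _ _ _ ζ).symm
  holder K _ ζ := by
    by_cases hζ : ζ = 1
    · subst hζ
      simpa only [basisForest_one, hX.map_one, Forest.size_one, Nat.cast_zero, mul_zero,
        Real.rpow_zero] using isBigO_refl _ _
    · obtain ⟨C, hC⟩ := hX.exists_holder_projIcc hγ hT hζ
      refine IsBigO.of_bound C (.of_forall fun p => ?_)
      rw [Real.norm_of_nonneg (r := |p.2 - p.1| ^ _) (by positivity)]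
      exact hC p.1 p.2

end IsBranchedRoughPath

namespace IsBimap

variable {γ : ℝ} {Γ : ℝ → ℝ → ForestSpace d →ₗ[ℝ] ForestSpace d}

theorem leftAction_counit_comp (hΓ : IsBimap γ Γ) (s t : ℝ) :
    leftAction (counit ∘ₗ Γ s t) = Γ s t := by
  obtain ⟨g, hg⟩ := hΓ.mem s t
  rw [hg, counit_comp_leftAction]

theorem counit_apply_one (hΓ : IsBimap γ Γ) (s t : ℝ) : counit (Γ s t 1) = 1 := by
  obtain ⟨g, hg⟩ := hΓ.mem s t
  rw [hg, ← LinearMap.comp_apply, counit_comp_leftAction, AlgHom.toLinearMap_apply, map_one]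

theorem isLineRoughPath (hΓ : IsBimap γ Γ) : IsLineRoughPath γ fun s t => counit ∘ₗ Γ t s where
  exists_char s t := (hΓ.mem t s).imp fun g hg => by rw [hg, counit_comp_leftAction]
  diag t := by rw [hΓ.diag, LinearMap.comp_id]
  chen s u t := LinearMap.ext fun x => by
    rw [convolution_apply, hΓ.leftAction_counit_comp, ← hΓ.comp t u s]
    rfl
  holder K hK ζ := by
    obtain ⟨C, hC⟩ := hΓ.bound K hK ζ.size
    by_cases hζ : ζ = 1
    · subst hζ
      simpa only [basisForest_one, LinearMap.comp_apply, hΓ.counit_apply_one, Forest.size_one,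
        Nat.cast_zero, mul_zero, Real.rpow_zero] using isBigO_refl _ _
    · refine IsBigO.of_bound C (eventually_principal.2 fun p hp => ?_)
      have hsize : 0 < ζ.size := Nat.pos_of_ne_zero (mt Forest.size_eq_zero.1 hζ)
      have h := hC p.2 hp.2 p.1 hp.1 _ (basisForest_mem_level ζ) 0 hsize
      rw [forestNorm_basisForest, mul_one, Nat.cast_zero, mul_zero, sub_zero] at h
      rw [Real.norm_of_nonneg (r := |p.2 - p.1| ^ _) (by positivity)]
      have hcoeff := abs_coeff_le_levelNorm (Γ p.2 p.1 (basisForest ζ)) 1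
      rw [Forest.size_one, ← counit_apply] at hcoeff
      exact hcoeff.trans h

end IsBimap

/-! ### The model of a rough path -/

/-- Testing a distribution against a probe. -/
def Probe.eval (q : Probe) : Tempered →ₗ[ℝ] ℝ :=
  LinearMap.applyₗ q.test ∘ₗ ContinuousLinearMap.coeLM ℝ

namespace IsContinuousFunction

theorem unique {ξ η : Tempered} {f : ℝ → ℝ} (hξ : IsContinuousFunction ξ f)
    (hη : IsContinuousFunction η f) : ξ = η := by
  ext u
  rw [(hξ.2 u).2, (hη.2 u).2]

theorem add {ξ η : Tempered} {f g : ℝ → ℝ} (hξ : IsContinuousFunction ξ f)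
    (hη : IsContinuousFunction η g) : IsContinuousFunction (ξ + η) (f + g) := by
  refine ⟨hξ.1.add hη.1, fun u => ?_⟩
  simp only [Pi.add_apply, add_mul]
  refine ⟨(hξ.2 u).1.add (hη.2 u).1, ?_⟩
  rw [integral_add (hξ.2 u).1 (hη.2 u).1, ← (hξ.2 u).2, ← (hη.2 u).2]
  rfl

theorem smul {ξ : Tempered} {f : ℝ → ℝ} (hξ : IsContinuousFunction ξ f) (c : ℝ) :
    IsContinuousFunction (c • ξ) (c • f) := by
  refine ⟨hξ.1.const_smul c, fun u => ?_⟩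
  simp only [Pi.smul_apply, smul_eq_mul, mul_assoc]
  refine ⟨(hξ.2 u).1.const_mul c, ?_⟩
  rw [integral_const_mul, ← (hξ.2 u).2]
  rfl

theorem exists_of_bounded {f : ℝ → ℝ} (hf : Continuous f) {C : ℝ} (hC : ∀ t, |f t| ≤ C) :
    ∃ ξ : Tempered, IsContinuousFunction ξ f := by
  have hm : MemLp f ⊤ volume := memLp_top_of_bound hf.aestronglyMeasurable C (.of_forall hC)
  refine ⟨(ContinuousLinearMap.lsmul ℝ ℝ).lpPairing volume ⊤ 1 (hm.toLp f) ∘L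
    SchwartzMap.toLpCLM ℝ ℝ 1 volume, hf, fun u => ⟨?_, ?_⟩⟩
  · exact u.integrable.bdd_mul hf.aestronglyMeasurable (.of_forall hC)
  · rw [ContinuousLinearMap.comp_apply, ContinuousLinearMap.lpPairing_eq_integral]
    refine integral_congr_ae ?_
    filter_upwards [hm.coeFn_toLp, u.coeFn_toLp 1 volume] with t hf_eq hu_eq
    change (hm.toLp f) t * (u.toLp 1 volume) t = _
    rw [hf_eq, hu_eq]

theorem exists_linearMap {V : Type*} [AddCommGroup V] [Module ℝ V] (Φ : V →ₗ[ℝ] ℝ → ℝ)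
    (hcont : ∀ x, Continuous (Φ x)) (hbdd : ∀ x, ∃ C, ∀ t, |Φ x t| ≤ C) :
    ∃ P : V →ₗ[ℝ] Tempered, ∀ x, IsContinuousFunction (P x) (Φ x) := by
  have hexists : ∀ x, ∃ ξ : Tempered, IsContinuousFunction ξ (Φ x) := fun x =>
    (hbdd x).elim fun _ hC => exists_of_bounded (hcont x) hC
  choose P hP using hexists
  let L : V →ₗ[ℝ] Tempered :=
    { toFun := P
      map_add' := fun x y =>
        (hP (x + y)).unique (by simpa only [map_add] using (hP x).add (hP y))
      map_smul' := fun c x =>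
        (hP (c • x)).unique (by simpa only [map_smul, RingHom.id_apply] using (hP x).smul c) }
  exact ⟨L, hP⟩

theorem abs_eval_le {ξ : Tempered} {f : ℝ → ℝ} (hξ : IsContinuousFunction ξ f) (q : Probe)
    {B : ℝ} (hB : ∀ t, |t - q.center| ≤ q.scale → |f t| ≤ B) : |q.eval ξ| ≤ 2 * B := by
  obtain ⟨s, δ, hδ, hδ1, u, hu⟩ := q
  have hB0 : 0 ≤ B := (abs_nonneg _).trans (hB s (by simpa only [sub_self, abs_zero] using hδ.le))
  have hout : ∀ t, t ∉ Icc (s - δ) (s + δ) → f t * rescale s δ hδ.ne' u t = 0 := fun t ht => by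
    rw [rescale_apply, image_eq_zero_of_notMem_tsupport (f := u), mul_zero, mul_zero]
    intro hmem
    have hball := hu.1 hmem
    rw [Metric.mem_ball, dist_zero_right, norm_mul, norm_inv, Real.norm_of_nonneg hδ.le,
      inv_mul_lt_one₀ hδ, Real.norm_eq_abs, abs_lt] at hball
    exact ht ⟨by linarith, by linarith⟩
  have hin : ∀ t ∈ Icc (s - δ) (s + δ), ‖f t * rescale s δ hδ.ne' u t‖ ≤ B * δ⁻¹ := fun t ht => by
    have hts : |t - s| ≤ δ := abs_le.2 ⟨by linarith [ht.1], by linarith [ht.2]⟩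
    rw [norm_mul, rescale_apply, norm_mul, Real.norm_of_nonneg (inv_pos.2 hδ).le]
    exact mul_le_mul (hB t hts) (mul_le_of_le_one_right (by positivity) (hu.2 _).1)
      (by positivity) hB0
  calc |ξ (rescale s δ hδ.ne' u)|
      = ‖∫ t in Icc (s - δ) (s + δ), f t * rescale s δ hδ.ne' u t‖ := by
        rw [(hξ.2 _).2, setIntegral_eq_integral_of_forall_compl_eq_zero hout, Real.norm_eq_abs]
    _ ≤ B * δ⁻¹ * volume.real (Icc (s - δ) (s + δ)) :=
        norm_setIntegral_le_of_norm_le_const (by simp) hin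
    _ = 2 * B := by
        rw [Real.volume_real_Icc_of_le (by linarith)]
        field_simp
        ring

end IsContinuousFunction

namespace IsLineRoughPath

variable {γ : ℝ} {Y : ℝ → ℝ → Module.Dual ℝ (ForestSpace d)}
  {P : ℝ → ForestSpace d →ₗ[ℝ] Tempered}

theorem isBigO_eval (hY : IsLineRoughPath γ Y) (hγ : 0 ≤ γ)
    (hP : ∀ s x, IsContinuousFunction (P s x) fun t => Y s t x) {K : Set ℝ} (hK : IsCompact K)
    (ζ : Forest (Fin d)) :
    (fun q : Probe => q.eval (P q.center (basisForest ζ))) =O[𝓟 {q | q.center ∈ K}]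
      fun q => q.scale ^ (γ * (ζ.size : ℝ)) := by
  obtain ⟨C, hC0, hC⟩ := (hY.holder _ (hK.cthickening (r := 1)) ζ).exists_nonneg
  refine IsBigO.of_bound (2 * C) (eventually_principal.2 fun q (hq : q.center ∈ K) => ?_)
  have hpos := q.scale_pos
  rw [Real.norm_of_nonneg (r := q.scale ^ _) (by positivity), mul_assoc]
  refine (hP q.center _).abs_eval_le q fun t ht => ?_
  have hmem : ∀ r, |r - q.center| ≤ 1 → r ∈ Metric.cthickening 1 K := fun r hr =>
    Metric.closedBall_subset_cthickening hq 1 hr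
  have hYt := isBigOWith_principal.1 hC (q.center, t)
    ⟨hmem _ (by simp only [sub_self, abs_zero, zero_le_one]), hmem t (ht.trans q.scale_le_one)⟩
  rw [Real.norm_of_nonneg (r := |t - q.center| ^ _) (by positivity)] at hYt
  exact hYt.trans (by gcongr)

theorem isModel (hY : IsLineRoughPath γ Y) (hγ : 0 ≤ γ)
    (hP : ∀ s x, IsContinuousFunction (P s x) fun t => Y s t x) :
    IsModel γ P fun s t => leftAction (Y t s) where
  bimap := hY.isBimap
  comp s t := LinearMap.ext fun x => by
    refine IsContinuousFunction.unique ?_ (hP t x)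
    simpa only [LinearMap.comp_apply, hY.apply_leftAction] using hP s (leftAction (Y t s) x)
  bound K hK k := by
    obtain ⟨C, hC⟩ := (isBigO_prod_level (Φ := fun q : Probe => q.eval ∘ₗ P q.center)
      (l := 𝓟 {q | q.center ∈ K}) (w := fun q => q.scale ^ (γ * (k : ℝ))) (k := k)
      fun ζ hζ => by
        subst hζ
        exact hY.isBigO_eval hγ hP hK ζ).bound
    rw [prod_principal_principal, eventually_principal] at hC
    refine ⟨C, fun s hs δ hδ hδ1 a ha u hu => ?_⟩
    have h := hC (⟨s, δ, hδ, hδ1, u, hu⟩, a) ⟨hs, ha⟩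
    rw [Real.norm_of_nonneg (r := _ * forestNorm a)
      (mul_nonneg (by positivity) (forestNorm_nonneg a))] at h
    exact h.trans_eq (by ring)

end IsLineRoughPath

theorem IsBranchedRoughPath.exists_corresponds {γ T : ℝ}
    {X : Icc (0 : ℝ) T → Icc (0 : ℝ) T → Module.Dual ℝ (ForestSpace d)}
    (hX : IsBranchedRoughPath γ T X) (hγ : 0 < γ) (hT : 0 ≤ T) :
    ∃ M ∈ normalizedModels d γ T, Corresponds X M := by
  set p := projIcc 0 T hT with hp
  have hY : IsLineRoughPath γ fun s t => X (p s) (p t) := hX.isLineRoughPath_projIcc hγ.le hT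
  have hbdd : ∀ s x, ∃ C, ∀ t, |X (p s) (p t) x| ≤ C := fun s x => by
    obtain ⟨C, hC⟩ := (isCompact_Icc (a := (0 : ℝ)) (b := T)).exists_bound_of_continuousOn
      (hY.continuous_right hγ s x).continuousOn
    exact ⟨C, fun t => by simpa only [hp, projIcc_val, Real.norm_eq_abs] using hC (p t) (p t).2⟩
  choose P hP using fun s => IsContinuousFunction.exists_linearMap
    (LinearMap.pi fun t => X (p s) (p t)) (hY.continuous_right hγ s) (hbdd s)
  have hone : ∀ s, IsContinuousFunction (P s 1) fun _ => 1 := fun s =>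
    funext (fun t => hY.map_one s t) ▸ hP s 1
  refine ⟨(P, fun s t => leftAction (X (p t) (p s))),
    ⟨hY.isModel hγ.le hP, hone, fun s t hs ht => ?_, fun s t hs ht => ?_⟩,
    fun s x => ⟨_, hP s x, fun t => ?_⟩, fun s t x => ?_⟩
  · simp only [hp, projIcc_of_le_left hT hs, projIcc_of_le_left hT ht, hX.diag, leftAction_counit]
  · simp only [hp, projIcc_of_right_le hT hs, projIcc_of_right_le hT ht, hX.diag,
      leftAction_counit]
  · simp only [LinearMap.pi_apply, hp, projIcc_val]
  · simp only [hp, projIcc_val]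

/-! ### Uniqueness of the model -/

theorem IsLineRoughPath.isBigO_one {γ : ℝ} {Y : ℝ → ℝ → Module.Dual ℝ (ForestSpace d)}
    (hY : IsLineRoughPath γ Y) (hγ : 0 ≤ γ) {K : Set ℝ} (hK : IsCompact K) (ζ : Forest (Fin d)) :
    (fun p : ℝ × ℝ => Y p.1 p.2 (basisForest ζ)) =O[𝓟 (K ×ˢ K)] fun _ => (1 : ℝ) := by
  have hcont : Continuous fun p : ℝ × ℝ => |p.2 - p.1| ^ (γ * (ζ.size : ℝ)) :=
    (by fun_prop : Continuous fun p : ℝ × ℝ => |p.2 - p.1|).rpow_const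
      fun _ => Or.inr (by positivity)
  exact (hY.holder K hK ζ).trans
    (hcont.continuousOn.isBigO_principal (hK.prod hK) (norm_ne_zero_iff.2 one_ne_zero))

namespace IsModel

variable {γ : ℝ} {P P' : ℝ → ForestSpace d →ₗ[ℝ] Tempered}
  {Γ : ℝ → ℝ → ForestSpace d →ₗ[ℝ] ForestSpace d}

theorem isBigO_eval (h : IsModel γ P Γ) {K : Set ℝ} (hK : IsCompact K) (ζ : Forest (Fin d)) :
    (fun q : Probe => q.eval (P q.center (basisForest ζ))) =O[𝓟 {q | q.center ∈ K}]
      fun q => q.scale ^ (γ * (ζ.size : ℝ)) := by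
  obtain ⟨C, hC⟩ := h.bound K hK ζ.size
  refine IsBigO.of_bound C (eventually_principal.2 fun q hq => ?_)
  have hpos := q.scale_pos
  rw [Real.norm_of_nonneg (r := q.scale ^ _) (by positivity)]
  have hq' := hC q.center hq q.scale hpos q.scale_le_one _ (basisForest_mem_level ζ) _ q.profile_mem
  rwa [forestNorm_basisForest, mul_one] at hq'

theorem isBigO_eval_sub (h : IsModel γ P Γ) (h' : IsModel γ P' Γ) (hγ : 0 ≤ γ)
    (hone : ∀ s, P s 1 = P' s 1) {K : Set ℝ} (hK : IsCompact K) (ζ : Forest (Fin d)) :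
    (fun q : Probe => q.eval ((P q.center - P' q.center) (basisForest ζ)))
      =O[𝓟 {q | q.center ∈ K}] fun q => q.scale ^ γ := by
  by_cases hζ : ζ = 1
  · subst hζ
    simpa only [LinearMap.sub_apply, basisForest_one, hone, sub_self, map_zero] using
      isBigO_zero _ _
  · have hscale : (fun q : Probe => q.scale ^ (γ * (ζ.size : ℝ)))
        =O[𝓟 {q | q.center ∈ K}] fun q => q.scale ^ γ := by
      refine IsBigO.of_bound' (.of_forall fun q => ?_)
      have hpos := q.scale_pos
      rw [Real.norm_of_nonneg (by positivity), Real.norm_of_nonneg (by positivity)]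
      refine Real.rpow_le_rpow_of_exponent_ge hpos q.scale_le_one (le_mul_of_one_le_right hγ ?_)
      exact_mod_cast Nat.one_le_iff_ne_zero.2 (mt Forest.size_eq_zero.1 hζ)
    simpa only [LinearMap.sub_apply, map_sub] using
      ((h.isBigO_eval hK ζ).sub (h'.isBigO_eval hK ζ)).trans hscale

theorem eq_comp_leftAction (h : IsModel γ P Γ) (s t : ℝ) :
    P t = P s ∘ₗ leftAction (counit ∘ₗ Γ s t) := by
  rw [h.bimap.leftAction_counit_comp, h.comp]

/-- Re-expanding `Π_t - Π'_t` around the centre of each probe leaves only terms of positive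
homogeneity, since the two models agree on the empty forest. -/
theorem eq_of_map_one_eq (h : IsModel γ P Γ) (h' : IsModel γ P' Γ) (hγ : 0 < γ)
    (hone : ∀ s, P s 1 = P' s 1) : P = P' := by
  refine funext fun t => linearMap_ext fun ζ => sub_eq_zero.1 <|
    Tempered.eq_zero_of_isBigO hγ fun K hK => ?_
  have hrecenter : ∀ q : Probe, (P t (basisForest ζ) - P' t (basisForest ζ)) q.test =
      convolution (counit ∘ₗ Γ q.center t) (q.eval ∘ₗ (P q.center - P' q.center))
        (basisForest ζ) := fun q => by
    rw [convolution_apply, h.eq_comp_leftAction q.center t, h'.eq_comp_leftAction q.center t]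
    rfl
  simp only [hrecenter]
  refine convolution_isBigO ζ fun a b _ => ?_
  have hpair : Tendsto (fun q : Probe => (t, q.center)) (𝓟 {q | q.center ∈ K})
      (𝓟 (insert t K ×ˢ insert t K)) :=
    tendsto_principal_principal.2 fun q hq => ⟨mem_insert t K, mem_insert_of_mem t hq⟩
  have hcoeff := (h.bimap.isLineRoughPath.isBigO_one hγ.le (hK.insert t) a).comp_tendsto hpair
  simpa only [one_mul, Function.comp_def, LinearMap.comp_apply] using
    hcoeff.mul (h.isBigO_eval_sub h' hγ.le hone hK b)

end IsModel

section NormalizedModels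

variable {γ T : ℝ} {M N : (ℝ → ForestSpace d →ₗ[ℝ] Tempered) ×
  (ℝ → ℝ → ForestSpace d →ₗ[ℝ] ForestSpace d)}

theorem snd_apply_projIcc_eq_id (hM : M ∈ normalizedModels d γ T) (hT : 0 ≤ T) (s : ℝ) :
    M.2 s (projIcc 0 T hT s) = LinearMap.id ∧ M.2 (projIcc 0 T hT s) s = LinearMap.id := by
  obtain ⟨hmodel, -, hleft, hright⟩ := hM
  rcases le_or_gt s 0 with h0 | h0
  · rw [projIcc_of_le_left hT h0]
    exact ⟨hleft _ _ h0 le_rfl, hleft _ _ le_rfl h0⟩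
  · rcases le_or_gt T s with h1 | h1
    · rw [projIcc_of_right_le hT h1]
      exact ⟨hright _ _ h1 le_rfl, hright _ _ le_rfl h1⟩
    · rw [projIcc_of_mem hT ⟨h0.le, h1.le⟩]
      exact ⟨hmodel.bimap.diag s, hmodel.bimap.diag s⟩

theorem snd_projIcc_projIcc (hM : M ∈ normalizedModels d γ T) (hT : 0 ≤ T) (s t : ℝ) :
    M.2 (projIcc 0 T hT s) (projIcc 0 T hT t) = M.2 s t := by
  have hΓ := hM.1.bimap
  rw [← hΓ.comp s (projIcc 0 T hT s) t, ← hΓ.comp (projIcc 0 T hT s) (projIcc 0 T hT t) t,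
    (snd_apply_projIcc_eq_id hM hT s).1, (snd_apply_projIcc_eq_id hM hT t).2, LinearMap.id_comp,
    LinearMap.comp_id]

theorem eq_of_mem_normalizedModels (hγ : 0 < γ) (hT : 0 ≤ T) (hM : M ∈ normalizedModels d γ T)
    (hN : N ∈ normalizedModels d γ T) (h : ∀ s t : Icc (0 : ℝ) T, M.2 s t = N.2 s t) : M = N := by
  have hΓ : M.2 = N.2 := funext₂ fun s t => by
    rw [← snd_projIcc_projIcc hM hT, ← snd_projIcc_projIcc hN hT, h]
  refine Prod.ext (IsModel.eq_of_map_one_eq hM.1 (hΓ ▸ hN.1) hγ fun s => ?_) hΓ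
  exact (hM.2.1 s).unique (hN.2.1 s)

end NormalizedModels

/-- The branched rough path `X_{st} = ε ∘ Γ_{ts}` of a model. -/
def roughPathOfModel {γ T : ℝ} (M : normalizedModels d γ T) : branchedRoughPaths d γ T :=
  ⟨fun s t => counit ∘ₗ M.1.2 t s, M.2.1.bimap.isLineRoughPath.isBranchedRoughPath⟩

theorem Corresponds.roughPathOfModel_eq {γ T : ℝ} {X : branchedRoughPaths d γ T}
    {M : normalizedModels d γ T} (h : Corresponds X.1 M.1) : roughPathOfModel M = X := by
  refine Subtype.ext (funext₂ fun s t => ?_)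
  change counit ∘ₗ M.1.2 t s = X.1 s t
  rw [LinearMap.ext (h.2 t s), counit_comp_leftAction]

theorem roughPathOfModel_injective {γ T : ℝ} (hγ : 0 < γ) (hT : 0 ≤ T) :
    Function.Injective (roughPathOfModel : normalizedModels d γ T → branchedRoughPaths d γ T) := by
  refine fun M N h => Subtype.ext (eq_of_mem_normalizedModels hγ hT M.2 N.2 fun s t => ?_)
  have hcounit : counit ∘ₗ M.1.2 s t = counit ∘ₗ N.1.2 s t :=
    congrFun₂ (congrArg Subtype.val h) t s
  rw [← M.2.1.bimap.leftAction_counit_comp, hcounit, N.2.1.bimap.leftAction_counit_comp]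

end ConnesKreimer

end

theorem mainTheorem6_general (d : ℕ) (γ T : ℝ) (hγ : 0 < γ) (hT : 0 ≤ T) :
    ∃ I : branchedRoughPaths d γ T → normalizedModels d γ T,
      Function.Bijective I ∧
      ∀ X : branchedRoughPaths d γ T,
        Corresponds X.1 (I X).1 ∧
        ∀ M : normalizedModels d γ T, Corresponds X.1 M.1 → M = I X := by
  have hexists : ∀ X : branchedRoughPaths d γ T, ∃ M : normalizedModels d γ T,
      Corresponds X.1 M.1 := fun X =>
    let ⟨M, hM, hXM⟩ := X.2.exists_corresponds hγ hT
    ⟨⟨M, hM⟩, hXM⟩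
  choose I hI using hexists
  have hleft : ∀ X, roughPathOfModel (I X) = X := fun X => (hI X).roughPathOfModel_eq
  have hinj := roughPathOfModel_injective (d := d) hγ hT
  refine ⟨I, ⟨Function.LeftInverse.injective hleft, fun M => ⟨_, hinj (hleft _)⟩⟩,
    fun X => ⟨hI X, fun M hM => hinj ?_⟩⟩
  rw [hM.roughPathOfModel_eq, hleft]

theorem mainTheorem6 (d : ℕ) (γ T : ℝ) (hγ₀ : 0 < γ) (hγ₁ : γ < 1) (hT : 0 < T) :
    ∃ I : branchedRoughPaths d γ T → normalizedModels d γ T,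
      Function.Bijective I ∧
      ∀ X : branchedRoughPaths d γ T,
        Corresponds X.1 (I X).1 ∧
        ∀ M : normalizedModels d γ T, Corresponds X.1 M.1 → M = I X :=
  mainTheorem6_general d γ T hγ₀ hT.le
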